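/- **Conventions.** For a real random variable $\xi$ put $\|\xi\|_{\psi_2}=\inf\{s>0:\ \mathbb E\exp((|\xi|/s)^2)\le 2\}$ and $\mathcal L(\xi,t)=\sup_{y\in\mathbb R}\mathbb P(|\xi-y|\le t)$. For given $p>0$ and $K\ge 1$, consider the condition $$(\ast)\qquad \mathbb E\,\xi=0,\qquad \|\xi\|_{\psi_2}\le K,\qquad \mathcal L(\xi,1)\le 1-p .$$ Let $\mathrm{Sparse}(s)\subset\mathbb R^n$ be the set of vectors with at most $s$ nonzero coordinates, and let $\mathrm{Incomp}(s,t)=\{x\in S^{n-1}:\ \mathrm{dist}(x,\mathrm{Sparse}(s))>t\}$. An $l$-tuple of vectors $v_1,\dots,v_l\in\mathbb R^n\setminus\{0\}$ is called $\nu$-almost orthogonal if the $n\times l$ matrix $W$ with columns $v_j/\|v_j\|_2$ has singular values $s_1(W)\ge\dots\ge s_l(W)$ satisfying $1-\nu\le s_l(W)\le s_1(W)\le 1+\nu$. All distances are Euclidean. **Proposition 5.1.** Let $p>0$, $K\ge 1$ and $\tau\in(0,1)$. There exists $\rho_0>0$, depending only on $p,K,\tau$, such that the following holds for every $\rho\in(0,\rho_0)$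 and all natural numbers $n,k,l$ with $$1\le l\le k\le \frac{\rho}{2}\sqrt n .$$ Put $L=\sqrt{k/p}$, and let $B$ be an $(n-k)\times n$ random matrix with i.i.d. entries satisfying $(\ast)$. Let $\mathcal E_l$ be the event that there exist vectors $v_1,\dots,v_l\in\ker(B)$ such that 1. $\frac{\tau}{8}\sqrt n\le\|v_j\|_2\le\exp\left(\frac{\rho^2 n}{4L^2}\right)$ for all $j\in\{1,\dots,l\}$; 2. $\mathrm{span}(v_1,\dots,v_l)\cap S^{n-1}\subset\mathrm{Incomp}(\tau^2 n,\tau^4)$; 3. the tuple $(v_1,\dots,v_l)$ is $\frac18$-almost orthogonal; 4. $\mathrm{dist}(v_j,\mathbb Z^n)\le\rho\sqrt n$ for all $j\in\{1,\dots,l\}$; 5. the $n\times l$ matrix $V$ with columns $v_1,\dots,v_l$ satisfies $\mathrm{dist}(V\theta,\mathbb Z^n)>\rho\sqrt n$ for all $\theta\in\mathbb R^l$ such that $\|\theta\|_2\le\frac{1}{20\sqrt l}$ and $\|V\theta\|_2\ge\frac{\tau}{8}\sqrt n$. Then $\mathbb P(\mathcal E_l)\le\exp(-ln)$. -/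

import Mathlib

open MeasureTheory ProbabilityTheory
open scoped ENNReal

noncomputable section

namespace RandomKernel

/-! ### Random entries -/

/-- The subgaussian norm `‖ξ‖_{ψ₂} = inf {s > 0 : E exp ((|ξ| / s)²) ≤ 2}`, with value `∞` when
there is no such `s`. -/
def psi2Norm {Ω : Type*} [MeasurableSpace Ω] (ξ : Ω → ℝ) (μ : Measure Ω) : ℝ≥0∞ :=
  ⨅ (s : ℝ) (_ : 0 < s ∧ ∫⁻ ω, ENNReal.ofReal (Real.exp ((|ξ ω| / s) ^ 2)) ∂μ ≤ 2),
    ENNReal.ofReal s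

/-- The Levy concentration function `ℒ(X, t) = sup_y P (‖X - y‖ ≤ t)`. -/
def levyConcentration {Ω E : Type*} [MeasurableSpace Ω] [NormedAddCommGroup E]
    (X : Ω → E) (t : ℝ) (μ : Measure Ω) : ℝ≥0∞ :=
  ⨆ y : E, μ {ω | ‖X ω - y‖ ≤ t}

/-- The conditions `E ξ = 0`, `‖ξ‖_{ψ₂} ≤ K`, `ℒ(ξ, 1) ≤ 1 - p` on a random variable `ξ`.
The bound on the subgaussian norm makes `ξ` integrable, so the mean is a genuine one. -/
structure EntryCondition {Ω : Type*} [MeasurableSpace Ω] (p K : ℝ) (ξ : Ω → ℝ)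
    (μ : Measure Ω) : Prop where
  aemeasurable : AEMeasurable ξ μ
  mean_zero : ∫ ω, ξ ω ∂μ = 0
  psi2Norm_le : psi2Norm ξ μ ≤ ENNReal.ofReal K
  levy_le : levyConcentration ξ 1 μ ≤ ENNReal.ofReal (1 - p)

/-- The entries of the random `m × n` matrix `B` are independent and identically distributed,
and each of them satisfies the conditions of `EntryCondition`. -/
structure IIDEntries {Ω : Type*} [MeasurableSpace Ω] {m n : ℕ} (p K : ℝ)
    (B : Ω → Matrix (Fin m) (Fin n) ℝ) (μ : Measure Ω) : Prop where
  indep : iIndepFun (fun (ij : Fin m × Fin n) (ω : Ω) => B ω ij.1 ij.2) μ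
  identDistrib : ∀ i i' j j', IdentDistrib (fun ω => B ω i j) (fun ω => B ω i' j') μ μ
  entry : ∀ i j, EntryCondition p K (fun ω => B ω i j) μ

/-! ### Sparse, compressible and incompressible vectors -/

/-- The set of `s`-sparse vectors of `ℝⁿ`; `s` is a real number, as in `Sparse (τ² n)`. -/
def Sparse (n : ℕ) (s : ℝ) : Set (EuclideanSpace ℝ (Fin n)) :=
  {x | ((Finset.univ.filter fun i => x i ≠ 0).card : ℝ) ≤ s}

/-- The unit vectors at distance at most `τ` from `Sparse s`. -/
def Comp (n : ℕ) (s τ : ℝ) : Set (EuclideanSpace ℝ (Fin n)) :=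
  {x | x ∈ Metric.sphere 0 1 ∧ Metric.infDist x (Sparse n s) ≤ τ}

/-- The unit vectors that are not compressible. -/
def Incomp (n : ℕ) (s τ : ℝ) : Set (EuclideanSpace ℝ (Fin n)) :=
  Metric.sphere 0 1 \ Comp n s τ

/-! ### Tuples of vectors -/

/-- The integer lattice `ℤⁿ` in `ℝⁿ`. -/
def intLattice (n : ℕ) : Set (EuclideanSpace ℝ (Fin n)) :=
  {x | ∀ i, ∃ z : ℤ, x i = z}

/-- The `n × l` matrix with columns `v₁, …, v_l`. -/
def colMatrix {n l : ℕ} (v : Fin l → EuclideanSpace ℝ (Fin n)) : Matrix (Fin n) (Fin l) ℝ :=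
  Matrix.of fun i j => v j i

/-- `ν`-almost orthogonality of an `l`-tuple (`l ≥ 1`) of nonzero vectors: the `n × l` matrix `W`
with columns `v_j / ‖v_j‖` satisfies `1 - ν ≤ s_l(W) ≤ s_1(W) ≤ 1 + ν`. Mathlib numbers the
singular values from `0` on, in decreasing order, so that `s_i(W)` has the index `i - 1`. -/
def AlmostOrthogonal {n l : ℕ} (ν : ℝ) (v : Fin l → EuclideanSpace ℝ (Fin n)) : Prop :=
  (∀ j, v j ≠ 0) ∧
  1 - ν ≤ (colMatrix fun j => ‖v j‖⁻¹ • v j).toEuclideanLin.singularValues (l - 1) ∧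
  (colMatrix fun j => ‖v j‖⁻¹ • v j).toEuclideanLin.singularValues 0 ≤ 1 + ν

/-- The properties required of the tuple `v₁, …, v_l` of vectors in `ℝⁿ`. -/
structure GoodTuple {n l : ℕ} (τ ρ L : ℝ) (v : Fin l → EuclideanSpace ℝ (Fin n)) : Prop where
  norm_ge : ∀ j, τ / 8 * √n ≤ ‖v j‖
  norm_le : ∀ j, ‖v j‖ ≤ Real.exp (ρ ^ 2 * n / (4 * L ^ 2))
  incomp : (Submodule.span ℝ (Set.range v) : Set (EuclideanSpace ℝ (Fin n))) ∩
      Metric.sphere 0 1 ⊆ Incomp n (τ ^ 2 * n) (τ ^ 4)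
  almostOrthogonal : AlmostOrthogonal (1 / 8) v
  near_lattice : ∀ j, Metric.infDist (v j) (intLattice n) ≤ ρ * √n
  minimal : ∀ θ : EuclideanSpace ℝ (Fin l), ‖θ‖ ≤ 1 / (20 * √l) →
      τ / 8 * √n ≤ ‖(colMatrix v).toEuclideanLin θ‖ →
      ρ * √n < Metric.infDist ((colMatrix v).toEuclideanLin θ) (intLattice n)

/-- The event that the kernel of the random matrix `B` contains such an `l`-tuple. -/
def kernelEvent {Ω : Type*} {m n : ℕ} (l : ℕ) (τ ρ L : ℝ)
    (B : Ω → Matrix (Fin m) (Fin n) ℝ) : Set Ω :=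
  {ω | ∃ v : Fin l → EuclideanSpace ℝ (Fin n),
    (∀ j, v j ∈ LinearMap.ker (B ω).toEuclideanLin) ∧ GoodTuple τ ρ L v}

end RandomKernel

end

namespace RandomKernel

/-! The proof is a union bound over tuples from a net in ρℤⁿ. Given a good tuple v in the kernel,
`exists_rounding` moves each v_j to a point w_j of ρℤⁿ so that the squared Hilbert–Schmidt norm of
the image of the rounding error is O(lρ²‖B‖²_HS). Outside an event of probability at most exp(-n²),
‖B‖_HS is O(n). Since Bv_j = 0, the sum of all squared coordinates of the Bw_j is then at most
l·m·s², where m = n - k and s is a constant multiple of ρ√n.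

For fixed w the rows are independent, and each contributes a factor ∏_j Cρ√n/‖w_j‖
(`GoodTuple.integral_row_le`). An Esseen inequality reduces this to integrating over [-1,1]^l the
modulus of the characteristic function of (⟨w_j, ξ⟩/s)_j. By symmetrization this modulus is
exponentially small in the squared distance from multiples of ∑ θ_j w_j to ℤⁿ
(`GoodTuple.infDist_smul_sq_ge`). If the corresponding combination of the v_j is long, minimality of
the tuple yields exp(-pρ²n), which the upper bound on ‖v_j‖ makes harmless. If it is short,
incompressibility makes the distance comparable to the norm, and almost orthogonality yields a
product Gaussian with integral ∏ Cs/‖v_j‖.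

The net is small because its points lie within 3ρ√n of ℤⁿ: those of norm about 2^a√n number at most
(C2^a)^n, with no power of 1/ρ (`card_near_lattice_le`). Against the factor (Cρ/2^a)^m from m rows,
only an excess 2^{ak} remains. It is controlled by R^k, where R is the upper bound on the norms, and
the choice L² = k/p gives R^k = exp(pρ²n/4). For small ρ the sum over one net point is thus at most
exp(-n)/2; the bound being a product over j, the sum over l-tuples is at most the l-th power. -/

/-! ### A positive Fourier window and an Esseen inequality -/

lemma sub_sin_lower_bound {y : ℝ} (hy : 0 < y) : 1 / (1 + y ^ 2) ≤ 20 * (4 * (y - Real.sin y) / y ^ 3) := by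
  have hy3 : 0 < y ^ 3 := by positivity
  have key : y ^ 3 ≤ 80 * (y - Real.sin y) * (1 + y ^ 2) := by
    -- Taylor's formula serves on (0, 1], monotonicity of y - sin y on (1, 2], and sin y ≤ 1 beyond.
    rcases le_or_gt y 1 with h1 | h1
    · have hb := (abs_le.mp (Real.sin_bound (x := y) (by rw [abs_of_pos hy]; exact h1))).2
      rw [abs_of_pos hy] at hb
      have h4 : y ^ 4 ≤ y ^ 3 := by nlinarith
      have h5 : y ^ 3 / 80 ≤ y - Real.sin y := by nlinarith
      nlinarith [mul_nonneg (by linarith : 0 ≤ y - Real.sin y) (sq_nonneg y)]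
    · rcases le_or_gt y 2 with h2 | h2
      · have hmono : Monotone fun x : ℝ => x - Real.sin x := by
          apply monotone_of_deriv_nonneg
          · fun_prop
          · intro x
            rw [deriv_fun_sub (by fun_prop) (by fun_prop)]
            simp [Real.cos_le_one]
        have hb := (abs_le.mp (Real.sin_bound (x := 1) (by simp))).2
        have hm := hmono h1.le
        simp only [] at hm
        norm_num at hb
        have h5 : (1 : ℝ) / 10 ≤ y - Real.sin y := by linarith
        nlinarith [mul_le_mul_of_nonneg_right h5 (by positivity : 0 ≤ 1 + y ^ 2), sq_nonneg y]
      · have h5 : y / 2 ≤ y - Real.sin y := by linarith [Real.sin_le_one y]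
        nlinarith [mul_le_mul_of_nonneg_right h5 (by positivity : 0 ≤ 1 + y ^ 2)]
  rw [div_le_iff₀ (by positivity)]
  rw [show 20 * (4 * (y - Real.sin y) / y ^ 3) * (1 + y ^ 2) = (80 * (y - Real.sin y) * (1 + y ^ 2)) / y ^ 3 by ring]
  rwa [le_div_iff₀ hy3, one_mul]

/-- The Fourier transform of `t ↦ (1 - |t|)²` on `[-1, 1]`. -/
noncomputable def taperTransform (y : ℝ) : ℝ := 2 * ∫ t in (0 : ℝ)..1, (1 - t) ^ 2 * Real.cos (t * y)

lemma taperTransform_of_ne_zero {y : ℝ} (hy : y ≠ 0) :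
    taperTransform y = 4 * (y - Real.sin y) / y ^ 3 := by
  have hd : ∀ t : ℝ, HasDerivAt (fun t : ℝ => (1 - t) ^ 2 * Real.sin (t * y) / y
      - 2 * (1 - t) * Real.cos (t * y) / y ^ 2 - 2 * Real.sin (t * y) / y ^ 3)
      ((1 - t) ^ 2 * Real.cos (t * y)) t := by
    intro t
    have h1 : HasDerivAt (fun t : ℝ => 1 - t) (-1) t := by
      simpa using (hasDerivAt_id t).const_sub 1
    have h0 : HasDerivAt (fun t : ℝ => t * y) y t := by
      simpa using (hasDerivAt_id t).mul_const y
    have hs := h0.sin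
    have hc := h0.cos
    refine (((((h1.pow 2).mul hs).div_const y).sub
      (((h1.const_mul 2).mul hc).div_const (y ^ 2))).sub
      ((hs.const_mul 2).div_const (y ^ 3))).congr_deriv ?_
    simp only [Pi.pow_apply]
    field_simp
    push_cast
    ring
  rw [taperTransform, intervalIntegral.integral_eq_sub_of_hasDerivAt (fun t _ => hd t)
    (Continuous.intervalIntegrable (by fun_prop) _ _)]
  simp
  field_simp
  ring

lemma taperTransform_zero : taperTransform 0 = 2 / 3 := by
  have hd : ∀ t : ℝ, HasDerivAt (fun t : ℝ => t - t ^ 2 + t ^ 3 / 3) ((1 - t) ^ 2) t := by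
    intro t
    refine (((hasDerivAt_id t).sub (hasDerivAt_pow 2 t)).add
      ((hasDerivAt_pow 3 t).div_const 3)).congr_deriv ?_
    push_cast
    ring
  rw [taperTransform]
  simp only [mul_zero, Real.cos_zero, mul_one]
  rw [intervalIntegral.integral_eq_sub_of_hasDerivAt (fun t _ => hd t)
    (Continuous.intervalIntegrable (by fun_prop) _ _)]
  norm_num

lemma taperTransform_neg (y : ℝ) : taperTransform (-y) = taperTransform y := by
  simp [taperTransform]

/-- The triangle 1 - |t| would not do, since its transform vanishes at the nonzero multiples of 2π.
Its square has the same support and a strictly positive transform that decays exactly like y⁻². -/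
lemma one_div_one_add_sq_le (y : ℝ) : 1 / (1 + y ^ 2) ≤ 20 * taperTransform y := by
  rcases lt_trichotomy y 0 with h | h | h
  · have h' : 0 < -y := by linarith
    rw [← taperTransform_neg, taperTransform_of_ne_zero h'.ne', ← neg_sq]; exact sub_sin_lower_bound h'
  · subst h; rw [taperTransform_zero]; norm_num
  · rw [taperTransform_of_ne_zero h.ne']; exact sub_sin_lower_bound h

lemma integral_taper (y : ℝ) :
    ∫ t in Set.Icc (-1 : ℝ) 1, (((1 - |t|) ^ 2 : ℝ) : ℂ) * Complex.exp ((t * y : ℝ) * Complex.I)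
      = (taperTransform y : ℂ) := by
  rw [integral_Icc_eq_integral_Ioc, ← intervalIntegral.integral_of_le (by norm_num)]
  have hc : Continuous fun t : ℝ => (((1 - |t|) ^ 2 : ℝ) : ℂ) * Complex.exp ((t * y : ℝ) * Complex.I) := by
    fun_prop
  rw [← intervalIntegral.integral_add_adjacent_intervals (b := 0) (hc.intervalIntegrable _ _)
    (hc.intervalIntegrable _ _)]
  have hneg : ∫ t in (-1 : ℝ)..0, (((1 - |t|) ^ 2 : ℝ) : ℂ) * Complex.exp ((t * y : ℝ) * Complex.I)
      = ∫ t in (0 : ℝ)..1, (((1 - |t|) ^ 2 : ℝ) : ℂ) * Complex.exp ((-t * y : ℝ) * Complex.I) := by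
    have := intervalIntegral.integral_comp_neg (a := (0 : ℝ)) (b := 1)
      (fun t : ℝ => (((1 - |t|) ^ 2 : ℝ) : ℂ) * Complex.exp ((t * y : ℝ) * Complex.I))
    simp only [neg_zero] at this
    rw [← this]
    simp
  rw [hneg, ← intervalIntegral.integral_add (Continuous.intervalIntegrable (by fun_prop) _ _)
    (hc.intervalIntegrable _ _), taperTransform, Complex.ofReal_mul, ← intervalIntegral.integral_ofReal,
    ← intervalIntegral.integral_const_mul]
  apply intervalIntegral.integral_congr
  intro t ht
  rw [Set.uIcc_of_le (by norm_num)] at ht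
  simp only [abs_of_nonneg ht.1]
  push_cast
  rw [← mul_add, Complex.cos]
  ring_nf

/-- Lebesgue measure on the cube `[-1, 1]^l`. -/
noncomputable def cubeMeasure (l : ℕ) : Measure (Fin l → ℝ) :=
  Measure.pi fun _ => volume.restrict (Set.Icc (-1 : ℝ) 1)

instance (l : ℕ) : IsFiniteMeasure (cubeMeasure l) := by
  unfold cubeMeasure; infer_instance

lemma ae_cubeMeasure (l : ℕ) : ∀ᵐ t ∂cubeMeasure l, ∀ j, |t j| ≤ 1 := by
  rw [cubeMeasure, ae_all_iff]
  intro j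
  have h : ∀ᵐ x ∂(volume.restrict (Set.Icc (-1 : ℝ) 1)), |x| ≤ 1 := by
    filter_upwards [ae_restrict_mem measurableSet_Icc] with x hx
    exact abs_le.mpr hx
  exact (Measure.tendsto_eval_ae_ae (μ := fun _ : Fin l => volume.restrict (Set.Icc (-1 : ℝ) 1))).eventually h

/-- An Esseen type inequality. -/
lemma integral_prod_inv_one_add_sq_le {Ω : Type*} [MeasurableSpace Ω] (P : Measure Ω)
    [IsProbabilityMeasure P] {l : ℕ} (Y : Ω → Fin l → ℝ) (hY : Measurable Y) :
    ∫ ω, ∏ j, 1 / (1 + Y ω j ^ 2) ∂P ≤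
      20 ^ l * ∫ t, ‖∫ ω, Complex.exp ((∑ j, t j * Y ω j : ℝ) * Complex.I) ∂P‖ ∂cubeMeasure l := by
  have hYj : ∀ j, Measurable fun ω => Y ω j := fun j => (measurable_pi_apply j).comp hY
  have hnn : ∀ y, 0 ≤ taperTransform y := fun y => by
    have := one_div_one_add_sq_le y
    have : 0 ≤ 1 / (1 + y ^ 2) := by positivity
    linarith
  set h : (Fin l → ℝ) → ℝ := fun t => ∏ j, (1 - |t j|) ^ 2 with hh
  have hprod : ∀ ω, ((∏ j, taperTransform (Y ω j) : ℝ) : ℂ) =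
      ∫ t, (h t : ℂ) * Complex.exp ((∑ j, t j * Y ω j : ℝ) * Complex.I) ∂cubeMeasure l := by
    intro ω
    push_cast
    simp_rw [← integral_taper, cubeMeasure]
    rw [← integral_fintype_prod_eq_prod]
    congr 1
    ext t
    rw [Finset.prod_mul_distrib, ← Complex.exp_sum, Finset.sum_mul]
    simp [hh]
  have hbound : ∀ᵐ z ∂((cubeMeasure l).prod P),
      ‖(h z.1 : ℂ) * Complex.exp ((∑ j, z.1 j * Y z.2 j : ℝ) * Complex.I)‖ ≤ 1 := by
    have : ∀ᵐ z ∂((cubeMeasure l).prod P), ∀ j, |z.1 j| ≤ 1 :=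
      Measure.quasiMeasurePreserving_fst.ae (ae_cubeMeasure l)
    filter_upwards [this] with z hz
    rw [norm_mul, Complex.norm_exp_ofReal_mul_I, mul_one, Complex.norm_real, hh]
    simp only [norm_prod]
    apply Finset.prod_le_one
    · intros; positivity
    · intro j _
      rw [Real.norm_eq_abs, abs_of_nonneg (by positivity)]
      have := hz j
      have := abs_nonneg (z.1 j)
      nlinarith
  have hmeas : Measurable fun z : (Fin l → ℝ) × Ω =>
      (h z.1 : ℂ) * Complex.exp ((∑ j, z.1 j * Y z.2 j : ℝ) * Complex.I) := by
    have : ∀ j, Measurable fun z : (Fin l → ℝ) × Ω => Y z.2 j := fun j => (hYj j).comp measurable_snd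
    fun_prop
  have hint : Integrable (fun z : (Fin l → ℝ) × Ω =>
      (h z.1 : ℂ) * Complex.exp ((∑ j, z.1 j * Y z.2 j : ℝ) * Complex.I)) ((cubeMeasure l).prod P) :=
    Integrable.of_bound hmeas.aestronglyMeasurable 1 hbound
  -- Fubini brings out the characteristic function of `Y`; the weight `h` takes values in [0, 1] on
  -- the cube and is then discarded.
  have hswap : ((∫ ω, ∏ j, taperTransform (Y ω j) ∂P : ℝ) : ℂ) = ∫ t, (h t : ℂ) *
      ∫ ω, Complex.exp ((∑ j, t j * Y ω j : ℝ) * Complex.I) ∂P ∂cubeMeasure l := by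
    rw [← integral_complex_ofReal]
    simp_rw [← integral_const_mul]
    rw [integral_integral_swap hint]
    exact integral_congr_ae (Filter.Eventually.of_forall hprod)
  have hTint : Integrable (fun ω => ∏ j, taperTransform (Y ω j)) P := by
    have := hint.integral_prod_right
    simp only [← hprod] at this
    exact this.re
  calc ∫ ω, ∏ j, 1 / (1 + Y ω j ^ 2) ∂P ≤ ∫ ω, 20 ^ l * ∏ j, taperTransform (Y ω j) ∂P := by
        apply integral_mono_of_nonneg
        · exact Filter.Eventually.of_forall fun ω => by positivity
        · exact hTint.const_mul _
        · refine Filter.Eventually.of_forall fun ω => ?_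
          have : (20 : ℝ) ^ l = ∏ _j : Fin l, 20 := by simp
          simp only [this, ← Finset.prod_mul_distrib]
          exact Finset.prod_le_prod (fun j _ => by positivity) fun j _ => one_div_one_add_sq_le _
    _ = 20 ^ l * ∫ ω, ∏ j, taperTransform (Y ω j) ∂P := integral_const_mul _ _
    _ ≤ _ := by
        gcongr
        have hn : ∫ ω, ∏ j, taperTransform (Y ω j) ∂P =
            ‖((∫ ω, ∏ j, taperTransform (Y ω j) ∂P : ℝ) : ℂ)‖ := by
          rw [Complex.norm_real, Real.norm_eq_abs, abs_of_nonneg]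
          exact integral_nonneg fun ω => Finset.prod_nonneg fun j _ => hnn _
        rw [hn, hswap]
        refine norm_integral_le_of_norm_le ?_ ?_
        · refine Integrable.of_bound ?_ 1 ?_
          · have hm2 : Measurable fun z : (Fin l → ℝ) × Ω =>
                Complex.exp ((∑ j, z.1 j * Y z.2 j : ℝ) * Complex.I) := by
              have : ∀ j, Measurable fun z : (Fin l → ℝ) × Ω => Y z.2 j :=
                fun j => (hYj j).comp measurable_snd
              fun_prop
            exact (hm2.stronglyMeasurable.integral_prod_right' (ν := P)).norm.aestronglyMeasurable
          · refine Filter.Eventually.of_forall fun t => ?_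
            rw [norm_norm]
            refine (norm_integral_le_integral_norm _).trans ?_
            simp only [Complex.norm_exp_ofReal_mul_I]
            simp
        · filter_upwards [ae_cubeMeasure l] with t ht
          rw [norm_mul]
          refine mul_le_of_le_one_left (norm_nonneg _) ?_
          rw [Complex.norm_real, hh]
          simp only [norm_prod]
          apply Finset.prod_le_one
          · intros; positivity
          · intro j _
            rw [Real.norm_eq_abs, abs_of_nonneg (by positivity)]
            have := ht j
            have := abs_nonneg (t j)
            nlinarith

/-! ### Symmetrization and the distance to the integer lattice -/

/-- The squared modulus is the characteristic function of the difference of two independent copies.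
-/
lemma one_sub_norm_charFun_sq (ν : Measure ℝ) [IsProbabilityMeasure ν] (t : ℝ) :
    1 - ‖charFun ν t‖ ^ 2 = ∫ z, (1 - Real.cos (t * (z.1 - z.2))) ∂(ν.prod ν) := by
  have hmul : charFun ν t * charFun ν (-t) =
      ∫ z, Complex.exp ((t * (z.1 - z.2) : ℝ) * Complex.I) ∂(ν.prod ν) := by
    rw [charFun_apply_real, charFun_apply_real, ← integral_prod_mul]
    congr 1
    ext z
    rw [← Complex.exp_add]
    congr 1
    push_cast
    ring
  have hint : Integrable (fun z : ℝ × ℝ => Complex.exp ((t * (z.1 - z.2) : ℝ) * Complex.I))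
      (ν.prod ν) := by
    refine Integrable.of_bound (Continuous.aestronglyMeasurable (by fun_prop)) 1 ?_
    exact Filter.Eventually.of_forall fun z => (Complex.norm_exp_ofReal_mul_I _).le
  have hre : ‖charFun ν t‖ ^ 2 = ∫ z, Real.cos (t * (z.1 - z.2)) ∂(ν.prod ν) := by
    rw [charFun_neg, Complex.mul_conj, Complex.normSq_eq_norm_sq] at hmul
    have h2 := congrArg Complex.re hmul
    rw [Complex.ofReal_re] at h2
    rw [h2]
    have := integral_re hint
    simp only [RCLike.re_eq_complex_re, Complex.exp_ofReal_mul_I_re] at this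
    exact this.symm
  rw [hre, integral_sub (integrable_const _)]
  · simp
  · refine Integrable.of_bound (Continuous.aestronglyMeasurable (by fun_prop)) 1 ?_
    exact Filter.Eventually.of_forall fun z => by simpa using Real.abs_cos_le_one _

lemma le_exp_neg_one_sub_sq_div_two (r : ℝ) : r ≤ Real.exp (-(1 - r ^ 2) / 2) := by
  have h1 : r ^ 2 ≤ Real.exp (-(1 - r ^ 2) / 2) ^ 2 := by
    rw [← Real.exp_nat_mul]
    have := Real.add_one_le_exp (r ^ 2 - 1)
    push_cast
    ring_nf at this ⊢
    linarith
  exact le_of_abs_le (abs_le_of_sq_le_sq h1 (Real.exp_pos _).le)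

/-- Each factor is at most exp(-(1 - |φ|²)/2), and the exponents add up under a single integral over
one difference z.1 - z.2. That difference rescales the whole vector `x` at once, so the sum of
cosines can be compared with the distance from one vector to the lattice. Outside `A` the integrand
is only used to be nonnegative. -/
lemma prod_norm_charFun_le {n : ℕ} (ν : Measure ℝ) [IsProbabilityMeasure ν] (x : Fin n → ℝ)
    {A : Set (ℝ × ℝ)} (hA : MeasurableSet A) {c q : ℝ} (hc : 0 ≤ c) (hq : q ≤ (ν.prod ν).real A)
    (h : ∀ z ∈ A, c ≤ ∑ i, (1 - Real.cos (x i * (z.1 - z.2)))) :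
    ∏ i, ‖charFun ν (x i)‖ ≤ Real.exp (-(c * q / 2)) := by
  have hint : ∀ i, Integrable (fun z : ℝ × ℝ => 1 - Real.cos (x i * (z.1 - z.2))) (ν.prod ν) := by
    intro i
    refine (integrable_const _).sub ?_
    refine Integrable.of_bound (Continuous.aestronglyMeasurable (by fun_prop)) 1 ?_
    exact Filter.Eventually.of_forall fun z => by simpa using Real.abs_cos_le_one _
  have hsum : c * q ≤ ∑ i, (1 - ‖charFun ν (x i)‖ ^ 2) := by
    simp_rw [one_sub_norm_charFun_sq]
    rw [← integral_finsetSum _ fun i _ => hint i]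
    calc c * q ≤ c * (ν.prod ν).real A := by gcongr
      _ = ∫ z, A.indicator (fun _ => c) z ∂(ν.prod ν) := by
        rw [integral_indicator hA]; simp [mul_comm]
      _ ≤ _ := by
        refine integral_mono ((integrable_const _).indicator hA)
          (integrable_finsetSum _ fun i _ => hint i) fun z => ?_
        by_cases hz : z ∈ A
        · simpa [hz] using h z hz
        · simp only [hz, not_false_eq_true, Set.indicator_of_notMem]
          exact Finset.sum_nonneg fun i _ => by linarith [Real.cos_le_one (x i * (z.1 - z.2))]
  calc ∏ i, ‖charFun ν (x i)‖ ≤ ∏ i, Real.exp (-(1 - ‖charFun ν (x i)‖ ^ 2) / 2) :=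
        Finset.prod_le_prod (fun _ _ => norm_nonneg _) fun i _ => le_exp_neg_one_sub_sq_div_two _
    _ = Real.exp (∑ i, -(1 - ‖charFun ν (x i)‖ ^ 2) / 2) := (Real.exp_sum _ _).symm
    _ ≤ _ := by
        rw [Real.exp_le_exp, ← Finset.sum_div, Finset.sum_neg_distrib]
        linarith

lemma eight_mul_sub_round_sq_le (y : ℝ) : 8 * (y - round y) ^ 2 ≤ 1 - Real.cos (2 * Real.pi * y) := by
  have h1 : Real.cos (2 * Real.pi * y) = Real.cos (2 * Real.pi * (y - round y)) := by
    rw [mul_sub, show 2 * Real.pi * (round y : ℝ) = (round y : ℝ) * (2 * Real.pi) by ring,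
      Real.cos_sub_int_mul_two_pi]
  have hpi := Real.pi_pos
  have h2 := Real.cos_le_one_sub_mul_cos_sq (x := 2 * Real.pi * (y - round y)) (by
    rw [abs_mul, abs_of_pos (by positivity)]
    nlinarith [abs_sub_round y])
  rw [h1]
  have h3 : 2 / Real.pi ^ 2 * (2 * Real.pi * (y - round y)) ^ 2 = 8 * (y - round y) ^ 2 := by
    field_simp; ring
  linarith

lemma infDist_intLattice_sq_le {n : ℕ} (y : EuclideanSpace ℝ (Fin n)) :
    Metric.infDist y (intLattice n) ^ 2 ≤ ∑ i, (y i - round (y i)) ^ 2 := by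
  have hmem : (WithLp.toLp 2 fun i => (round (y i) : ℝ) : EuclideanSpace ℝ (Fin n)) ∈ intLattice n :=
    fun i => ⟨round (y i), rfl⟩
  have h := Metric.infDist_le_dist_of_mem (x := y) hmem
  have h2 : Metric.infDist y (intLattice n) ^ 2 ≤
      dist y (WithLp.toLp 2 fun i => (round (y i) : ℝ)) ^ 2 := by
    gcongr; exact Metric.infDist_nonneg
  refine h2.trans (le_of_eq ?_)
  rw [EuclideanSpace.dist_eq, Real.sq_sqrt (by positivity)]
  simp [Real.dist_eq, sq_abs]

lemma eight_mul_infDist_sq_le {n : ℕ} (y : EuclideanSpace ℝ (Fin n)) :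
    8 * Metric.infDist y (intLattice n) ^ 2 ≤ ∑ i, (1 - Real.cos (2 * Real.pi * y i)) := by
  calc _ ≤ 8 * ∑ i, (y i - round (y i)) ^ 2 := by gcongr; exact infDist_intLattice_sq_le y
    _ ≤ _ := by
      rw [Finset.mul_sum]
      exact Finset.sum_le_sum fun i _ => eight_mul_sub_round_sq_le _

lemma integral_pi_exp {n : ℕ} (ν : Measure ℝ) [IsProbabilityMeasure ν] (x : Fin n → ℝ) :
    ∫ ξ, Complex.exp ((∑ i, x i * ξ i : ℝ) * Complex.I) ∂(Measure.pi fun _ : Fin n => ν) =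
      ∏ i, charFun ν (x i) := by
  simp_rw [charFun_apply_real]
  rw [← integral_fintype_prod_eq_prod]
  congr 1
  ext ξ
  rw [← Complex.exp_sum, ← Finset.sum_mul]
  push_cast
  rfl

/-! ### Differences of entries of moderate size -/

/-- Otherwise every unit interval around an integer would be null, and these cover the line. The
bound ensures that `ENNReal.ofReal (1 - p)` does not truncate a negative number. -/
lemma levy_parameter_le_one {ν : Measure ℝ} [IsProbabilityMeasure ν] {p : ℝ}
    (h : ∀ y, ν {x | |x - y| ≤ 1} ≤ ENNReal.ofReal (1 - p)) : p ≤ 1 := by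
  by_contra hp
  push Not at hp
  have h0 : ∀ y, ν {x | |x - y| ≤ 1} = 0 := fun y => by
    have := h y
    rw [ENNReal.ofReal_of_nonpos (by linarith)] at this
    exact nonpos_iff_eq_zero.mp this
  have hun : (Set.univ : Set ℝ) ⊆ ⋃ z : ℤ, {x : ℝ | |x - z| ≤ 1} := by
    intro x _
    refine Set.mem_iUnion.mpr ⟨round x, ?_⟩
    have := abs_sub_round x
    simp only [Set.mem_ofPred_eq]
    linarith
  have : ν Set.univ = 0 := measure_mono_null hun (measure_iUnion_null fun z => h0 z)
  simp at this

/-- By Fubini the difference of two copies is at most 1 in modulus with probability at most 1 - p,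
and the two tails cost p/4 each. The lower cutoff gives the lattice distance its size; the upper
cutoff keeps the rescaled coefficients in the range of the minimality condition. -/
lemma exists_truncation {p K : ℝ} (hp : 0 < p) (hK : 1 ≤ K) : ∃ M : ℝ, 1 ≤ M ∧
    ∀ (ν : Measure ℝ) [IsProbabilityMeasure ν],
      ∫⁻ x, ENNReal.ofReal (Real.exp ((x / (2 * K)) ^ 2)) ∂ν ≤ 2 →
      (∀ y, ν {x | |x - y| ≤ 1} ≤ ENNReal.ofReal (1 - p)) →
      p / 2 ≤ (ν.prod ν).real {z | 1 < |z.1 - z.2| ∧ |z.1 - z.2| ≤ M} := by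
  -- Then exp(t²) ≥ t ≥ 8/p, so Markov's inequality bounds the tail beyond 2Kt by 2/(8/p) = p/4.
  obtain ⟨t, ht1, htp⟩ : ∃ t : ℝ, 1 ≤ t ∧ 8 / p ≤ t := ⟨max 1 (8 / p), le_max_left _ _, le_max_right _ _⟩
  refine ⟨4 * K * t, by nlinarith, fun ν _ hexp hlevy => ?_⟩
  have hp1 : p ≤ 1 := levy_parameter_le_one hlevy
  have htail : ν {x | 2 * K * t ≤ |x|} ≤ ENNReal.ofReal (p / 4) := by
    have hmk := mul_meas_ge_le_lintegral (μ := ν)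
      (f := fun x => ENNReal.ofReal (Real.exp ((x / (2 * K)) ^ 2))) (by fun_prop)
      (ENNReal.ofReal (8 / p))
    have hsub : {x : ℝ | 2 * K * t ≤ |x|} ⊆
        {x | ENNReal.ofReal (8 / p) ≤ ENNReal.ofReal (Real.exp ((x / (2 * K)) ^ 2))} := by
      intro x hx
      apply ENNReal.ofReal_le_ofReal
      have hx' : t ≤ |x / (2 * K)| := by
        rw [abs_div, abs_of_pos (by positivity : 0 < 2 * K), le_div_iff₀ (by positivity)]
        simp only [Set.mem_ofPred_eq] at hx
        linarith
      have h1 : t ^ 2 ≤ (x / (2 * K)) ^ 2 := by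
        rw [← sq_abs (x / (2 * K))]; gcongr
      have := Real.add_one_le_exp ((x / (2 * K)) ^ 2)
      nlinarith
    have h2 : ENNReal.ofReal (8 / p) * ν {x | 2 * K * t ≤ |x|} ≤ 2 :=
      (mul_le_mul_right (measure_mono hsub) _).trans (hmk.trans hexp)
    have h3 : ENNReal.ofReal (8 / p) * ENNReal.ofReal (p / 4) = 2 := by
      rw [← ENNReal.ofReal_mul (by positivity)]
      rw [show 8 / p * (p / 4) = 2 by field_simp; norm_num]; simp
    rw [← h3] at h2
    refine (ENNReal.mul_le_mul_iff_right ?_ ENNReal.ofReal_ne_top).mp h2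
    simpa using hp
  have hdiag : (ν.prod ν) {z | |z.1 - z.2| ≤ 1} ≤ ENNReal.ofReal (1 - p) := by
    rw [Measure.prod_apply_symm (measurableSet_le (by fun_prop) (by fun_prop))]
    calc _ ≤ ∫⁻ _, ENNReal.ofReal (1 - p) ∂ν := lintegral_mono fun y => hlevy y
      _ = _ := by simp
  have htm : MeasurableSet {x : ℝ | 2 * K * t ≤ |x|} := measurableSet_le (by fun_prop) (by fun_prop)
  have ht1' : (ν.prod ν) {z | 2 * K * t ≤ |z.1|} ≤ ENNReal.ofReal (p / 4) := by
    have : {z : ℝ × ℝ | 2 * K * t ≤ |z.1|} = {x | 2 * K * t ≤ |x|} ×ˢ Set.univ := by ext; simp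
    rw [this, Measure.prod_prod]; simpa using htail
  have ht2' : (ν.prod ν) {z | 2 * K * t ≤ |z.2|} ≤ ENNReal.ofReal (p / 4) := by
    have : {z : ℝ × ℝ | 2 * K * t ≤ |z.2|} = Set.univ ×ˢ {x | 2 * K * t ≤ |x|} := by ext; simp
    rw [this, Measure.prod_prod]; simpa using htail
  set A := {z : ℝ × ℝ | 1 < |z.1 - z.2| ∧ |z.1 - z.2| ≤ 4 * K * t}
  have hA : MeasurableSet A := by
    have h1 : MeasurableSet {z : ℝ × ℝ | 1 < |z.1 - z.2|} :=
      measurableSet_lt (by fun_prop) (by fun_prop)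
    have h2 : MeasurableSet {z : ℝ × ℝ | |z.1 - z.2| ≤ 4 * K * t} :=
      measurableSet_le (by fun_prop) (by fun_prop)
    exact h1.inter h2
  have hcov : Aᶜ ⊆ {z : ℝ × ℝ | |z.1 - z.2| ≤ 1} ∪ ({z | 2 * K * t ≤ |z.1|} ∪ {z | 2 * K * t ≤ |z.2|}) := by
    intro z hz
    simp only [A, Set.mem_compl_iff, Set.mem_ofPred_eq, Set.mem_union, not_and_or, not_lt, not_le] at hz ⊢
    rcases hz with hz | hz
    · exact Or.inl hz
    · right
      by_contra hcon
      push Not at hcon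
      have := abs_sub z.1 z.2
      linarith
  have hcompl : (ν.prod ν).real Aᶜ ≤ 1 - p + (p / 4 + p / 4) := by
    refine ENNReal.toReal_le_of_le_ofReal (by linarith) ?_
    rw [ENNReal.ofReal_add (by linarith) (by positivity), ENNReal.ofReal_add (by positivity) (by positivity)]
    refine (measure_mono hcov).trans ((measure_union_le _ _).trans ?_)
    gcongr
    refine (measure_union_le _ _).trans ?_
    gcongr
  have := probReal_add_probReal_compl (μ := ν.prod ν) hA
  linarith

/-! ### Good tuples and distances to the lattice -/

lemma singularValue_mul_norm_le {E F : Type*} [NormedAddCommGroup E] [InnerProductSpace ℝ E]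
    [FiniteDimensional ℝ E] [NormedAddCommGroup F] [InnerProductSpace ℝ F] [FiniteDimensional ℝ F]
    (T : E →ₗ[ℝ] F) (x : E) :
    T.singularValues (Module.finrank ℝ E - 1) * ‖x‖ ≤ ‖T x‖ := by
  have hS := T.isSymmetric_adjoint_comp_self
  set b := hS.eigenvectorBasis rfl with hb
  have hTx : ‖T x‖ ^ 2 = ∑ i : Fin (Module.finrank ℝ E),
      T.singularValues i ^ 2 * (b.repr x i) ^ 2 := by
    have h1 : ‖T x‖ ^ 2 = inner ℝ x ((LinearMap.adjoint T ∘ₗ T) x) := by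
      rw [LinearMap.comp_apply, LinearMap.adjoint_inner_right, real_inner_self_eq_norm_sq]
    rw [h1, ← b.repr.inner_map_map, PiLp.inner_apply]
    refine Finset.sum_congr rfl fun i _ => ?_
    rw [hS.eigenvectorBasis_apply_self_apply rfl x i, T.sq_singularValues_fin rfl i]
    simp [hb]
    ring
  have hx : ‖x‖ ^ 2 = ∑ i, (b.repr x i) ^ 2 := by
    rw [← b.repr.norm_map, EuclideanSpace.norm_sq_eq]
    simp
  refine le_of_sq_le_sq ?_ (norm_nonneg _)
  rw [mul_pow, hTx, hx, Finset.mul_sum]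
  refine Finset.sum_le_sum fun i _ => ?_
  gcongr
  · exact T.singularValues_nonneg _
  · exact T.singularValues_antitone (by have := i.2; omega)

lemma toEuclideanLin_colMatrix {n l : ℕ} (v : Fin l → EuclideanSpace ℝ (Fin n))
    (θ : EuclideanSpace ℝ (Fin l)) :
    (colMatrix v).toEuclideanLin θ = ∑ j, θ j • v j := by
  ext i
  simp [colMatrix, Matrix.toEuclideanLin, Matrix.toLpLin_apply, Matrix.mulVec, dotProduct, mul_comm]

/-- Multiplying θ_j by ‖v_j‖ passes to the normalized columns, whose least singular value is at
least 7/8. -/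
lemma AlmostOrthogonal.norm_sum_smul_sq_ge {n l : ℕ} {v : Fin l → EuclideanSpace ℝ (Fin n)}
    (hv : AlmostOrthogonal (1 / 8) v) (θ : EuclideanSpace ℝ (Fin l)) :
    49 / 64 * ∑ j, ‖v j‖ ^ 2 * θ j ^ 2 ≤ ‖∑ j, θ j • v j‖ ^ 2 := by
  obtain ⟨h0, h1, -⟩ := hv
  set η : EuclideanSpace ℝ (Fin l) := WithLp.toLp 2 fun j => ‖v j‖ * θ j with hη
  have h2 := singularValue_mul_norm_le (colMatrix fun j => ‖v j‖⁻¹ • v j).toEuclideanLin η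
  rw [finrank_euclideanSpace_fin, toEuclideanLin_colMatrix] at h2
  have h3 : ∑ j, η j • ‖v j‖⁻¹ • v j = ∑ j, θ j • v j := by
    refine Finset.sum_congr rfl fun j _ => ?_
    have : ‖v j‖ ≠ 0 := norm_ne_zero_iff.mpr (h0 j)
    rw [smul_smul, hη]
    congr 1
    simp
    field_simp
  rw [h3] at h2
  have h4 : ‖η‖ ^ 2 = ∑ j, ‖v j‖ ^ 2 * θ j ^ 2 := by
    rw [EuclideanSpace.norm_sq_eq]
    simp [hη, mul_pow]
  have h5 : 7 / 8 * ‖η‖ ≤ ‖∑ j, θ j • v j‖ := by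
    refine le_trans ?_ h2
    gcongr
    linarith
  rw [← h4]
  have := pow_le_pow_left₀ (by positivity) h5 2
  linarith

/-- A short vector with incompressible direction is far from the integer lattice. -/
lemma norm_le_infDist_intLattice {n : ℕ} {τ : ℝ} (hτ : 0 < τ)
    {x : EuclideanSpace ℝ (Fin n)} (hx : ‖x‖ < τ / 8 * √n)
    (hinc : x ≠ 0 → ‖x‖⁻¹ • x ∈ Incomp n (τ ^ 2 * n) (τ ^ 4)) :
    τ ^ 4 * ‖x‖ ≤ Metric.infDist x (intLattice n) := by
  by_cases hx0 : x = 0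
  · simp [hx0, Metric.infDist_nonneg]
  have hinc := hinc hx0
  have hxpos : 0 < ‖x‖ := norm_pos_iff.mpr hx0
  -- Small coordinates have 0 as a nearest integer, so no lattice point is closer to `x` than `y`
  -- is. Each surviving coordinate exceeds 1/2 in modulus, so at most 4‖x‖² ≤ τ²n/16 of them survive
  -- and `y` is sparse.
  set y : EuclideanSpace ℝ (Fin n) := WithLp.toLp 2 fun i => if |x i| ≤ 1 / 2 then 0 else x i with hy
  have hne : (intLattice n).Nonempty := ⟨0, fun i => ⟨0, by simp⟩⟩
  rw [Metric.le_infDist hne]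
  intro z hz
  have hxy : dist x y ≤ dist x z := by
    rw [EuclideanSpace.dist_eq, EuclideanSpace.dist_eq]
    apply Real.sqrt_le_sqrt
    refine Finset.sum_le_sum fun i _ => ?_
    obtain ⟨m, hm⟩ := hz i
    rw [hm, Real.dist_eq, Real.dist_eq, sq_abs, sq_abs]
    by_cases hi : |x i| ≤ 1 / 2
    · simp only [hy, hi, if_true, sub_zero]
      rw [sq_le_sq]
      rcases eq_or_ne m 0 with rfl | hm0
      · simp
      · have h1 : (1 : ℝ) ≤ |(m : ℝ)| := by exact_mod_cast Int.one_le_abs hm0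
        have := abs_sub_abs_le_abs_sub (m : ℝ) (x i)
        rw [abs_sub_comm (m : ℝ) (x i)] at this
        linarith
    · simp only [hy, hi, if_false, sub_self]
      rw [zero_pow two_ne_zero]
      positivity
  have hsp : ‖x‖⁻¹ • y ∈ Sparse n (τ ^ 2 * n) := by
    have hcard : ((Finset.univ.filter fun i => y i ≠ 0).card : ℝ) ≤ 4 * ‖x‖ ^ 2 := by
      rw [EuclideanSpace.norm_sq_eq, Finset.mul_sum]
      calc ((Finset.univ.filter fun i => y i ≠ 0).card : ℝ)
          = ∑ i ∈ Finset.univ.filter (fun i => y i ≠ 0), (1 : ℝ) := by simp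
        _ ≤ ∑ i ∈ Finset.univ.filter (fun i => y i ≠ 0), 4 * ‖x i‖ ^ 2 := by
            refine Finset.sum_le_sum fun i hi => ?_
            have hi' : ¬ |x i| ≤ 1 / 2 := by
              intro hcon
              exact (Finset.mem_filter.mp hi).2 (by simp only [hy, hcon, if_true])
            rw [Real.norm_eq_abs]
            nlinarith
        _ ≤ ∑ i, 4 * ‖x i‖ ^ 2 :=
            Finset.sum_le_sum_of_subset_of_nonneg (Finset.subset_univ _) fun i _ _ => by positivity
    have hsup : (Finset.univ.filter fun i => (‖x‖⁻¹ • y) i ≠ 0) = Finset.univ.filter fun i => y i ≠ 0 := by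
      ext i
      simp [hx0]
    simp only [Sparse, Set.mem_ofPred_eq]
    rw [hsup]
    refine hcard.trans ?_
    have : ‖x‖ ^ 2 ≤ (τ / 8 * √n) ^ 2 := by gcongr
    rw [mul_pow, Real.sq_sqrt (Nat.cast_nonneg n)] at this
    have hn : (0 : ℝ) ≤ τ ^ 2 * n := by positivity
    nlinarith
  have hlt : τ ^ 4 < Metric.infDist (‖x‖⁻¹ • x) (Sparse n (τ ^ 2 * n)) := by
    by_contra hcon
    exact hinc.2 ⟨hinc.1, not_lt.mp hcon⟩
  have h2 := hlt.le.trans (Metric.infDist_le_dist_of_mem hsp)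
  rw [dist_smul₀, norm_inv, norm_norm, inv_mul_eq_div, le_div_iff₀ hxpos] at h2
  exact h2.trans hxy

/-- The structural hypotheses hold for `v`, but the union bound needs the estimate for `w`. A long
combination of the v_j is at distance more than ρ√n by minimality, and replacing `v` by `w` loses at
most a tenth of this. A short one is at distance at least τ⁴ times its norm, and 64ρ ≤ τ⁵ makes the
replacement cost at most half. -/
lemma GoodTuple.infDist_smul_sq_ge {n l : ℕ} {τ ρ L M : ℝ} (hτ : 0 < τ) (hρ : 0 < ρ)
    (hρτ : 64 * ρ ≤ τ ^ 5) {v : Fin l → EuclideanSpace ℝ (Fin n)} (hv : GoodTuple τ ρ L v)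
    {w : Fin l → EuclideanSpace ℝ (Fin n)}
    (hw : ∀ θ : EuclideanSpace ℝ (Fin l), ‖∑ j, θ j • (w j - v j)‖ ≤ 2 * ρ * √n * ‖θ‖)
    (hl : 1 ≤ l)
    {θ : EuclideanSpace ℝ (Fin l)} (hθ : M * ‖θ‖ ≤ 1 / (20 * √l)) {z : ℝ} (hz1 : 1 ≤ |z|)
    (hzM : |z| ≤ M) :
    min (ρ ^ 2 * n / 2) (τ ^ 8 / 16 * ∑ j, ‖v j‖ ^ 2 * θ j ^ 2) ≤
      Metric.infDist (z • ∑ j, θ j • w j) (intLattice n) ^ 2 := by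
  set V := ∑ j, (z • θ) j • v j with hV
  have hsplit : z • ∑ j, θ j • w j = V + ∑ j, (z • θ) j • (w j - v j) := by
    rw [hV, ← Finset.sum_add_distrib, Finset.smul_sum]
    refine Finset.sum_congr rfl fun j _ => ?_
    simp [smul_smul, smul_sub]
  have hzθ : ‖z • θ‖ ≤ 1 / (20 * √l) := by
    rw [norm_smul, Real.norm_eq_abs]
    exact (mul_le_mul_of_nonneg_right hzM (norm_nonneg _)).trans hθ
  have hU := hw (z • θ)
  have hdist : Metric.infDist V (intLattice n) ≤
      Metric.infDist (z • ∑ j, θ j • w j) (intLattice n) + ‖∑ j, (z • θ) j • (w j - v j)‖ := by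
    have := Metric.infDist_le_infDist_add_dist (s := intLattice n) (x := V)
      (y := z • ∑ j, θ j • w j)
    rw [hsplit] at this ⊢
    simpa [dist_eq_norm] using this
  have hn : (0 : ℝ) ≤ √n := Real.sqrt_nonneg _
  have hsl : 1 ≤ √(l : ℝ) := by
    rw [Real.one_le_sqrt]; exact_mod_cast hl
  rcases le_or_gt (τ / 8 * √n) ‖V‖ with hcase | hcase
  · refine (min_le_left _ _).trans ?_
    have hmin := hv.minimal (z • θ) hzθ (by rw [toEuclideanLin_colMatrix]; exact hcase)
    rw [toEuclideanLin_colMatrix] at hmin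
    have h1 : 2 * ρ * √n * ‖z • θ‖ ≤ ρ * √n * (1 / 10) := by
      have : ‖z • θ‖ ≤ 1 / 20 := by
        refine hzθ.trans ?_
        gcongr
        linarith
      have h0 : 0 ≤ ρ * √n := by positivity
      nlinarith
    have h2 : 9 / 10 * (ρ * √n) ≤ Metric.infDist (z • ∑ j, θ j • w j) (intLattice n) := by linarith
    have h3 := pow_le_pow_left₀ (by positivity) h2 2
    rw [mul_pow, mul_pow ρ, Real.sq_sqrt (Nat.cast_nonneg n)] at h3
    have : (0 : ℝ) ≤ ρ ^ 2 * n := by positivity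
    linarith
  · refine (min_le_right _ _).trans ?_
    have hfar := norm_le_infDist_intLattice hτ hcase fun hV0 => hv.incomp
      ⟨Submodule.smul_mem _ _ (Submodule.sum_mem _ fun j _ => Submodule.smul_mem _ _
        (Submodule.subset_span ⟨j, rfl⟩)), by simp [norm_smul, hV0]⟩
    have hao := hv.almostOrthogonal.norm_sum_smul_sq_ge (z • θ)
    have hVθ : 7 / 64 * τ * √n * ‖z • θ‖ ≤ ‖V‖ := by
      refine le_of_sq_le_sq ?_ (norm_nonneg _)
      refine le_trans ?_ hao
      rw [mul_pow, EuclideanSpace.norm_sq_eq, Finset.mul_sum, Finset.mul_sum]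
      refine Finset.sum_le_sum fun j _ => ?_
      have h1 := pow_le_pow_left₀ (by positivity) (hv.norm_ge j) 2
      rw [Real.norm_eq_abs, sq_abs]
      have h2 := mul_le_mul_of_nonneg_right h1 (sq_nonneg ((z • θ) j))
      calc _ = 49 / 64 * ((τ / 8 * √n) ^ 2 * (z • θ) j ^ 2) := by ring
        _ ≤ _ := by linarith
    have hU2 : ‖∑ j, (z • θ) j • (w j - v j)‖ ≤ τ ^ 4 / 2 * ‖V‖ := by
      refine hU.trans ?_
      have h0 : 0 ≤ √n * ‖z • θ‖ := by positivity
      calc 2 * ρ * √n * ‖z • θ‖ = (2 * ρ) * (√n * ‖z • θ‖) := by ring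
        _ ≤ (τ ^ 4 / 2 * (7 / 64 * τ)) * (√n * ‖z • θ‖) := by
            refine mul_le_mul_of_nonneg_right ?_ h0
            have : 0 < τ ^ 5 := by positivity
            linarith [show τ ^ 4 / 2 * (7 / 64 * τ) = 7 / 128 * τ ^ 5 by ring]
        _ = τ ^ 4 / 2 * (7 / 64 * τ * √n * ‖z • θ‖) := by ring
        _ ≤ _ := by gcongr
    have h2 : τ ^ 4 / 2 * ‖V‖ ≤ Metric.infDist (z • ∑ j, θ j • w j) (intLattice n) := by linarith
    have h3 := pow_le_pow_left₀ (by positivity) h2 2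
    refine le_trans ?_ h3
    have hz2 : 1 ≤ z ^ 2 := by rw [← sq_abs]; nlinarith
    have h4 : ∑ j, ‖v j‖ ^ 2 * (z • θ) j ^ 2 = z ^ 2 * ∑ j, ‖v j‖ ^ 2 * θ j ^ 2 := by
      rw [Finset.mul_sum]
      refine Finset.sum_congr rfl fun j _ => ?_
      simp only [PiLp.smul_apply, smul_eq_mul]
      ring
    rw [h4] at hao
    have hS : 0 ≤ ∑ j, ‖v j‖ ^ 2 * θ j ^ 2 := Finset.sum_nonneg fun j _ => by positivity
    have h5 : 1 / 4 * ∑ j, ‖v j‖ ^ 2 * θ j ^ 2 ≤ ‖V‖ ^ 2 := by nlinarith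
    calc τ ^ 8 / 16 * ∑ j, ‖v j‖ ^ 2 * θ j ^ 2
        = τ ^ 8 / 4 * (1 / 4 * ∑ j, ‖v j‖ ^ 2 * θ j ^ 2) := by ring
      _ ≤ τ ^ 8 / 4 * ‖V‖ ^ 2 := by gcongr
      _ = _ := by ring

/-! ### The small ball estimate for one row -/

lemma cubeMeasure_real_univ (l : ℕ) : (cubeMeasure l).real Set.univ = 2 ^ l := by
  simp only [cubeMeasure, measureReal_def, Measure.pi_univ, Measure.restrict_apply_univ,
    Real.volume_Icc, Finset.prod_const, Finset.card_univ, Fintype.card_fin, ENNReal.toReal_pow]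
  norm_num

lemma integral_cubeMeasure_gaussian_le {l : ℕ} (b : Fin l → ℝ) (hb : ∀ j, 0 < b j) :
    ∫ t, Real.exp (-∑ j, b j * t j ^ 2) ∂cubeMeasure l ≤ ∏ j, √(Real.pi / b j) := by
  have h : ∀ t : Fin l → ℝ, Real.exp (-∑ j, b j * t j ^ 2) = ∏ j, Real.exp (-b j * t j ^ 2) := by
    intro t
    rw [← Real.exp_sum, ← Finset.sum_neg_distrib]
    simp
  simp_rw [h]
  rw [cubeMeasure, integral_fintype_prod_eq_prod (f := fun j x => Real.exp (-b j * x ^ 2))]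
  refine Finset.prod_le_prod (fun j _ => integral_nonneg fun x => (Real.exp_pos _).le) fun j _ => ?_
  rw [← integral_gaussian]
  exact setIntegral_le_integral (integrable_exp_neg_mul_sq (hb j))
    (Filter.Eventually.of_forall fun x => (Real.exp_pos _).le)

/-- The two exponentials are the two alternatives of the lattice distance bound, for the
coefficients θ = t/(2πs). The condition 4Ml ≤ s keeps M‖θ‖ within 1/(20√l), so minimality applies on
the whole cube. -/
lemma GoodTuple.norm_charFun_row_le {n l : ℕ} {τ ρ L M p s : ℝ} (hτ : 0 < τ) (hρ : 0 < ρ)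
    (hρτ : 64 * ρ ≤ τ ^ 5) (hp : 0 < p) (hM : 1 ≤ M)
    {v : Fin l → EuclideanSpace ℝ (Fin n)} (hv : GoodTuple τ ρ L v)
    {w : Fin l → EuclideanSpace ℝ (Fin n)}
    (hw : ∀ θ : EuclideanSpace ℝ (Fin l), ‖∑ j, θ j • (w j - v j)‖ ≤ 2 * ρ * √n * ‖θ‖)
    (hl : 1 ≤ l) (hs0 : 0 < s) (hs : 4 * M * l ≤ s)
    (ν : Measure ℝ) [IsProbabilityMeasure ν]
    (hν : p / 2 ≤ (ν.prod ν).real {z | 1 < |z.1 - z.2| ∧ |z.1 - z.2| ≤ M})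
    {t : Fin l → ℝ} (ht : ∀ j, |t j| ≤ 1) :
    ‖∫ ξ, Complex.exp ((∑ j, t j * ((∑ i, w j i * ξ i) / s) : ℝ) * Complex.I)
        ∂(Measure.pi fun _ : Fin n => ν)‖ ≤
      Real.exp (-(p * ρ ^ 2 * n)) +
        Real.exp (-∑ j, p * τ ^ 8 * ‖v j‖ ^ 2 / (32 * Real.pi ^ 2 * s ^ 2) * t j ^ 2) := by
  have hπ := Real.pi_pos
  have hA : MeasurableSet {z : ℝ × ℝ | 1 < |z.1 - z.2| ∧ |z.1 - z.2| ≤ M} := by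
    have h1 : MeasurableSet {z : ℝ × ℝ | 1 < |z.1 - z.2|} :=
      measurableSet_lt (by fun_prop) (by fun_prop)
    have h2 : MeasurableSet {z : ℝ × ℝ | |z.1 - z.2| ≤ M} :=
      measurableSet_le (by fun_prop) (by fun_prop)
    exact h1.inter h2
  set θ : EuclideanSpace ℝ (Fin l) := WithLp.toLp 2 fun j => t j / (2 * Real.pi * s) with hθ
  set x : Fin n → ℝ := fun i => 2 * Real.pi * (∑ j, θ j • w j) i with hx
  have hlin : ∀ ξ : Fin n → ℝ, ∑ j, t j * ((∑ i, w j i * ξ i) / s) = ∑ i, x i * ξ i := by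
    intro ξ
    simp only [hx, hθ, WithLp.ofLp_sum, WithLp.ofLp_smul, Finset.sum_apply, Pi.smul_apply, smul_eq_mul,
      Finset.mul_sum, Finset.sum_mul, Finset.sum_div]
    rw [Finset.sum_comm]
    refine Finset.sum_congr rfl fun i _ => Finset.sum_congr rfl fun j _ => ?_
    field_simp
  simp_rw [hlin]
  rw [integral_pi_exp, norm_prod]
  have hθn : M * ‖θ‖ ≤ 1 / (20 * √l) := by
    have hl0 : (0 : ℝ) < l := by exact_mod_cast hl
    have h1 : ‖θ‖ ≤ √l / (2 * Real.pi * s) := by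
      rw [EuclideanSpace.norm_eq]
      refine Real.sqrt_le_iff.mpr ⟨by positivity, ?_⟩
      rw [div_pow, Real.sq_sqrt hl0.le]
      calc ∑ j, ‖θ j‖ ^ 2 ≤ ∑ j : Fin l, 1 / (2 * Real.pi * s) ^ 2 := by
            refine Finset.sum_le_sum fun j _ => ?_
            simp only [hθ, Real.norm_eq_abs, sq_abs, div_pow]
            gcongr
            rw [← sq_abs]
            have := ht j
            have := abs_nonneg (t j)
            nlinarith
        _ = _ := by simp [div_eq_mul_inv]
    have hsq : √(l : ℝ) * √l = l := Real.mul_self_sqrt hl0.le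
    have hsl : 0 < √(l : ℝ) := Real.sqrt_pos.mpr hl0
    rw [le_div_iff₀ (by positivity)]
    calc M * ‖θ‖ * (20 * √l) ≤ M * (√l / (2 * Real.pi * s)) * (20 * √l) := by gcongr
      _ = 20 * M * (√l * √l) / (2 * Real.pi * s) := by ring
      _ = 20 * M * l / (2 * Real.pi * s) := by rw [hsq]
      _ ≤ 1 := by
          rw [div_le_one (by positivity)]
          nlinarith [Real.pi_gt_three, mul_pos (by linarith : 0 < M) hl0]
  set c := min (ρ ^ 2 * n / 2) (τ ^ 8 / 16 * ∑ j, ‖v j‖ ^ 2 * θ j ^ 2) with hc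
  have hc0 : 0 ≤ c := le_min (by positivity)
    (mul_nonneg (by positivity) (Finset.sum_nonneg fun j _ => by positivity))
  refine (prod_norm_charFun_le ν x hA (c := 8 * c) (by positivity) hν ?_).trans ?_
  · rintro ⟨a, a'⟩ ⟨h1, h2⟩
    have h3 := hv.infDist_smul_sq_ge hτ hρ hρτ hw hl hθn h1.le h2
    have h4 := eight_mul_infDist_sq_le ((a - a') • ∑ j, θ j • w j)
    have h5 : ∀ i, x i * (a - a') = 2 * Real.pi * ((a - a') • ∑ j, θ j • w j) i := by
      intro i
      simp only [hx, PiLp.smul_apply, smul_eq_mul]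
      ring
    simp only [h5]
    linarith
  · rcases min_choice (ρ ^ 2 * n / 2) (τ ^ 8 / 16 * ∑ j, ‖v j‖ ^ 2 * θ j ^ 2) with h | h
    · rw [hc, h]
      refine le_trans (le_of_eq ?_) (le_add_of_nonneg_right (Real.exp_pos _).le)
      congr 1
      ring
    · rw [hc, h]
      refine le_trans (le_of_eq ?_) (le_add_of_nonneg_left (Real.exp_pos _).le)
      congr 1
      simp only [hθ, Finset.mul_sum, Finset.sum_mul, Finset.sum_div]
      congr 1
      refine Finset.sum_congr rfl fun j _ => ?_
      field_simp
      ring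

/-- The small ball estimate for one row. -/
lemma GoodTuple.integral_row_le {n l : ℕ} {τ ρ L M p s : ℝ} (hτ : 0 < τ) (hρ : 0 < ρ)
    (hρτ : 64 * ρ ≤ τ ^ 5) (hp : 0 < p) (hM : 1 ≤ M)
    {v : Fin l → EuclideanSpace ℝ (Fin n)} (hv : GoodTuple τ ρ L v)
    {w : Fin l → EuclideanSpace ℝ (Fin n)}
    (hw : ∀ θ : EuclideanSpace ℝ (Fin l), ‖∑ j, θ j • (w j - v j)‖ ≤ 2 * ρ * √n * ‖θ‖)
    (hl : 1 ≤ l) (hs1 : 1 ≤ s) (hs : 4 * M * l ≤ s)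
    (hprod : ∏ j, ‖v j‖ ≤ Real.exp (p * ρ ^ 2 * n))
    (ν : Measure ℝ) [IsProbabilityMeasure ν]
    (hν : p / 2 ≤ (ν.prod ν).real {z | 1 < |z.1 - z.2| ∧ |z.1 - z.2| ≤ M}) :
    ∫ ξ, ∏ j, 1 / (1 + ((∑ i, w j i * ξ i) / s) ^ 2) ∂(Measure.pi fun _ : Fin n => ν) ≤
      ∏ j, (40 * (2 + √(32 * Real.pi ^ 3 / (p * τ ^ 8)))) * s / ‖v j‖ := by
  have hs0 : 0 < s := by linarith
  have hπ := Real.pi_pos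
  have hvpos : ∀ j, 0 < ‖v j‖ := fun j => norm_pos_iff.mpr (hv.almostOrthogonal.1 j)
  set b : Fin l → ℝ := fun j => p * τ ^ 8 * ‖v j‖ ^ 2 / (32 * Real.pi ^ 2 * s ^ 2) with hb
  have hbpos : ∀ j, 0 < b j := fun j => by
    have := hvpos j
    simp only [hb]; positivity
  have hY : Measurable fun (ξ : Fin n → ℝ) (j : Fin l) => (∑ i, w j i * ξ i) / s := by
    refine measurable_pi_lambda _ fun j => ?_
    fun_prop
  have hE := integral_prod_inv_one_add_sq_le (Measure.pi fun _ : Fin n => ν) _ hY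
  refine hE.trans ?_
  have hgint : Integrable (fun t : Fin l → ℝ => Real.exp (-∑ j, b j * t j ^ 2)) (cubeMeasure l) := by
    refine Integrable.of_bound (Continuous.aestronglyMeasurable (by fun_prop)) 1 ?_
    refine Filter.Eventually.of_forall fun t => ?_
    rw [Real.norm_eq_abs, Real.abs_exp, Real.exp_le_one_iff, neg_nonpos]
    exact Finset.sum_nonneg fun j _ => mul_nonneg (hbpos j).le (sq_nonneg _)
  set C₀ := √(32 * Real.pi ^ 3 / (p * τ ^ 8)) with hC₀
  have hC₀0 : 0 ≤ C₀ := Real.sqrt_nonneg _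
  set Q := ∏ j, s / ‖v j‖ with hQ
  have hQ0 : 0 ≤ Q := Finset.prod_nonneg fun j _ => by positivity
  have hI : ∫ t, ‖∫ ξ, Complex.exp ((∑ j, t j * ((∑ i, w j i * ξ i) / s) : ℝ) * Complex.I)
        ∂(Measure.pi fun _ : Fin n => ν)‖ ∂cubeMeasure l ≤ 2 ^ l * Q + C₀ ^ l * Q := by
    calc _ ≤ ∫ t, (Real.exp (-(p * ρ ^ 2 * n)) + Real.exp (-∑ j, b j * t j ^ 2)) ∂cubeMeasure l := by
          refine integral_mono_of_nonneg (Filter.Eventually.of_forall fun t => norm_nonneg _)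
            ((integrable_const _).add hgint) ?_
          filter_upwards [ae_cubeMeasure l] with t ht using
            hv.norm_charFun_row_le hτ hρ hρτ hp hM hw hl hs0 hs ν hν ht
      _ = 2 ^ l * Real.exp (-(p * ρ ^ 2 * n)) + ∫ t, Real.exp (-∑ j, b j * t j ^ 2) ∂cubeMeasure l := by
          rw [integral_add (integrable_const _) hgint, integral_const, cubeMeasure_real_univ, smul_eq_mul]
      _ ≤ _ := by
          gcongr
          -- The constant term is absorbed by the product of the inverse norms: this is where
          -- `hprod` is needed.
          · rw [hQ, Finset.prod_div_distrib, Real.exp_neg]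
            have h1 : (1 : ℝ) ≤ ∏ _j : Fin l, s := by
              simpa using one_le_pow₀ hs1
            have h2 : 0 < ∏ j, ‖v j‖ := Finset.prod_pos fun j _ => hvpos j
            calc (Real.exp (p * ρ ^ 2 * n))⁻¹ ≤ (∏ j, ‖v j‖)⁻¹ := by gcongr
              _ = 1 / ∏ j, ‖v j‖ := by rw [one_div]
              _ ≤ _ := by gcongr
          · refine (integral_cubeMeasure_gaussian_le b hbpos).trans (le_of_eq ?_)
            have : C₀ ^ l = ∏ _j : Fin l, C₀ := by simp
            rw [this, hQ, ← Finset.prod_mul_distrib]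
            refine Finset.prod_congr rfl fun j _ => ?_
            have h1 := hvpos j
            rw [hC₀, show Real.pi / b j = 32 * Real.pi ^ 3 / (p * τ ^ 8) * (s / ‖v j‖) ^ 2 by
              simp only [hb]; field_simp, Real.sqrt_mul (by positivity), Real.sqrt_sq (by positivity)]
  calc 20 ^ l * _ ≤ 20 ^ l * (2 ^ l * Q + C₀ ^ l * Q) := by gcongr
    -- The sum of two terms costs a factor 2 ≤ 2^l, which turns 20 into 40.
    _ ≤ 20 ^ l * (2 ^ l * (2 + C₀) ^ l * Q) := by
        gcongr
        have h1 : (2 : ℝ) ^ l ≤ (2 + C₀) ^ l := by gcongr; linarith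
        have h2 : C₀ ^ l ≤ (2 + C₀) ^ l := by gcongr; linarith
        have h3 : (2 : ℝ) ≤ 2 ^ l := by
          simpa using pow_le_pow_right₀ (by norm_num : (1 : ℝ) ≤ 2) hl
        have h4 : 0 ≤ (2 + C₀) ^ l := by positivity
        nlinarith [mul_nonneg (mul_nonneg (sub_nonneg.mpr h3) h4) hQ0]
    _ = _ := by
        rw [Finset.prod_congr rfl fun j _ => mul_div_assoc _ _ _, Finset.prod_mul_distrib,
          Finset.prod_const, Finset.card_univ, Fintype.card_fin, ← hQ, mul_pow,
          show (40 : ℝ) = 20 * 2 by norm_num, mul_pow]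
        ring

/-! ### Derandomized rounding -/

/-- Coordinatewise rounding to `α ℤ` along which a function with quadratic growth in each
coordinate stays bounded: each rounding direction is chosen so that the linear term is not
positive. -/
lemma exists_greedy_rounding {ι : Type*} [Fintype ι] [DecidableEq ι] (F : (ι → ℝ) → ℝ) {α : ℝ}
    (hα : 0 < α) (a : ι → ℝ) (ha : ∀ i, 0 ≤ a i)
    (hF : ∀ U i, (∀ i, |U i| ≤ α) → U i = 0 →
      ∃ b : ℝ, ∀ t, F (Function.update U i t) ≤ F U + b * t + a i * t ^ 2)
    (x : ι → ℝ) :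
    ∃ U : ι → ℝ, (∀ i, |U i| ≤ α) ∧ (∀ i, ∃ m : ℤ, x i + U i = α * m) ∧
      F U ≤ F 0 + ∑ i, a i * α ^ 2 := by
  suffices h : ∀ S : Finset ι, ∃ U : ι → ℝ, (∀ i, |U i| ≤ α) ∧ (∀ i ∉ S, U i = 0) ∧
      (∀ i ∈ S, ∃ m : ℤ, x i + U i = α * m) ∧ F U ≤ F 0 + ∑ i ∈ S, a i * α ^ 2 by
    obtain ⟨U, h1, -, h2, h3⟩ := h Finset.univ
    exact ⟨U, h1, fun i => h2 i (Finset.mem_univ i), h3⟩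
  intro S
  induction S using Finset.induction_on with
  | empty => exact ⟨0, fun i => by simpa using hα.le, fun i _ => rfl, by simp, by simp⟩
  | insert i S hi ih =>
    obtain ⟨U, h1, h2, h3, h4⟩ := ih
    obtain ⟨b, hb⟩ := hF U i h1 (h2 i hi)
    have hf1 : (⌊x i / α⌋ : ℝ) * α ≤ x i := by
      rw [← le_div_iff₀ hα]; exact Int.floor_le _
    have hf2 : x i < (⌊x i / α⌋ + 1 : ℝ) * α := by
      rw [← div_lt_iff₀ hα]; exact Int.lt_floor_add_one _
    obtain ⟨t, m, htα, htm, hbt⟩ : ∃ (t : ℝ) (m : ℤ), |t| ≤ α ∧ x i + t = α * m ∧ b * t ≤ 0 := by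
      rcases le_total 0 b with hb0 | hb0
      · refine ⟨⌊x i / α⌋ * α - x i, ⌊x i / α⌋, ?_, by ring, ?_⟩
        · rw [abs_le]; constructor <;> linarith
        · exact mul_nonpos_of_nonneg_of_nonpos hb0 (by linarith)
      · refine ⟨(⌊x i / α⌋ + 1) * α - x i, ⌊x i / α⌋ + 1, ?_, by push_cast; ring, ?_⟩
        · rw [abs_le]; constructor <;> linarith
        · exact mul_nonpos_of_nonpos_of_nonneg hb0 (by linarith)
    refine ⟨Function.update U i t, fun j => ?_, fun j hj => ?_, fun j hj => ?_, ?_⟩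
    · by_cases hji : j = i
      · subst hji; simpa using htα
      · simpa [hji] using h1 j
    · rw [Finset.mem_insert, not_or] at hj
      simpa [hj.1] using h2 j hj.2
    · by_cases hji : j = i
      · subst hji; exact ⟨m, by simpa using htm⟩
      · simpa [hji] using h3 j ((Finset.mem_insert.mp hj).resolve_left hji)
    · rw [Finset.sum_insert hi]
      have ht2 : t ^ 2 ≤ α ^ 2 := by rw [← sq_abs]; gcongr
      have := mul_le_mul_of_nonneg_left ht2 (ha i)
      linarith [hb t]

/-- The squared Hilbert-Schmidt norm of `B Uᵀ`, where `U` has rows indexed by the first factor. -/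
def imageEnergy {m n l : ℕ} (B : Matrix (Fin m) (Fin n) ℝ) (U : Fin l × Fin n → ℝ) : ℝ :=
  ∑ r, ∑ j, (∑ i, B r i * U (j, i)) ^ 2

/-- The off-diagonal part of the Gram matrix of the rows of `U`. -/
def offGram {n l : ℕ} (U : Fin l × Fin n → ℝ) (j k : Fin l) : ℝ :=
  if j = k then 0 else ∑ i, U (j, i) * U (k, i)

lemma imageEnergy_update {m n l : ℕ} (B : Matrix (Fin m) (Fin n) ℝ) (U : Fin l × Fin n → ℝ)
    (x : Fin l × Fin n) (hx : U x = 0) :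
    ∃ b : ℝ, ∀ t, imageEnergy B (Function.update U x t) =
      imageEnergy B U + b * t + (∑ r, B r x.2 ^ 2) * t ^ 2 := by
  obtain ⟨j₀, i₀⟩ := x
  have hrow : ∀ t r j, ∑ i, B r i * Function.update U (j₀, i₀) t (j, i) =
      ∑ i, B r i * U (j, i) + if j = j₀ then B r i₀ * t else 0 := by
    intro t r j
    have h1 : ∀ i, B r i * Function.update U (j₀, i₀) t (j, i) =
        B r i * U (j, i) + if i = i₀ then (if j = j₀ then B r i₀ * t else 0) else 0 := by
      intro i
      by_cases hi : i = i₀ <;> by_cases hj : j = j₀ <;> simp [hi, hj, hx]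
    simp [h1, Finset.sum_add_distrib]
  refine ⟨∑ r, 2 * B r i₀ * ∑ i, B r i * U (j₀, i), fun t => ?_⟩
  simp only [imageEnergy, hrow]
  rw [Finset.sum_mul, Finset.sum_mul, ← Finset.sum_add_distrib, ← Finset.sum_add_distrib]
  refine Finset.sum_congr rfl fun r _ => ?_
  have h2 : ∀ j, (∑ i, B r i * U (j, i) + if j = j₀ then B r i₀ * t else 0) ^ 2 =
      (∑ i, B r i * U (j, i)) ^ 2 +
        if j = j₀ then 2 * B r i₀ * t * (∑ i, B r i * U (j₀, i)) + B r i₀ ^ 2 * t ^ 2 else 0 := by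
    intro j
    by_cases hj : j = j₀
    · subst hj; simp; ring
    · simp [hj]
  simp only [h2, Finset.sum_add_distrib, Finset.sum_ite_eq', Finset.mem_univ, if_true]
  ring

/-- With the diagonal removed, every Gram entry is affine in `t`. The coefficients of `t` are
nonzero only in one row and one column, with modulus at most α, hence 2lα². -/
lemma offGram_update {n l : ℕ} {U : Fin l × Fin n → ℝ} {α : ℝ} (hα : 0 < α)
    (hU : ∀ x, |U x| ≤ α) (x : Fin l × Fin n) (hx : U x = 0) :
    ∃ b : ℝ, ∀ t, ∑ j, ∑ k, offGram (Function.update U x t) j k ^ 2 ≤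
      ∑ j, ∑ k, offGram U j k ^ 2 + b * t + (2 * l * α ^ 2) * t ^ 2 := by
  obtain ⟨j₀, i₀⟩ := x
  set c : Fin l → Fin l → ℝ := fun j k => if j = k then 0 else
    (if j = j₀ then U (k, i₀) else 0) + (if k = j₀ then U (j, i₀) else 0) with hc
  have hrow : ∀ t j k, offGram (Function.update U (j₀, i₀) t) j k = offGram U j k + t * c j k := by
    intro t j k
    by_cases hjk : j = k
    · simp [offGram, hc, hjk]
    simp only [offGram, hc, hjk, if_false]
    have h1 : ∀ i, Function.update U (j₀, i₀) t (j, i) * Function.update U (j₀, i₀) t (k, i) =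
        U (j, i) * U (k, i) + if i = i₀ then t * ((if j = j₀ then U (k, i₀) else 0) +
          (if k = j₀ then U (j, i₀) else 0)) else 0 := by
      intro i
      by_cases hi : i = i₀
      · by_cases hj : j = j₀
        · have hk : k ≠ j₀ := fun h => hjk (hj.trans h.symm)
          simp [hi, hj, hk, hx]
        · by_cases hk : k = j₀
          · simp [hi, hj, hk, hx, mul_comm]
          · simp [hi, hj, hk]
      · simp [hi]
    simp [h1, Finset.sum_add_distrib]
  have hc2 : ∑ j, ∑ k, c j k ^ 2 ≤ 2 * l * α ^ 2 := by
    have hsq : ∀ x, U x ^ 2 ≤ α ^ 2 := fun x => by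
      rw [← sq_abs]; exact pow_le_pow_left₀ (abs_nonneg _) (hU x) 2
    calc ∑ j, ∑ k, c j k ^ 2
        ≤ ∑ j : Fin l, ∑ k : Fin l, ((if j = j₀ then α ^ 2 else 0) + (if k = j₀ then α ^ 2 else 0)) := by
          refine Finset.sum_le_sum fun j _ => Finset.sum_le_sum fun k _ => ?_
          have h0 : 0 ≤ α ^ 2 := by positivity
          have hj' := hsq (j, i₀)
          have hk' := hsq (k, i₀)
          by_cases hjk : j = k
          · simp only [hc, hjk, if_true]
            split_ifs <;> norm_num [h0]
          · by_cases hj : j = j₀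
            · have hk : k ≠ j₀ := fun h => hjk (hj.trans h.symm)
              simp only [hc, hj, hk, if_true, if_false, add_zero]
              rw [if_neg (Ne.symm hk)]
              exact hk'
            · by_cases hk : k = j₀
              · simp only [hc, hj, hk, if_true, if_false, zero_add]
                exact hj'
              · simp [hc, hj, hk]
      _ = 2 * l * α ^ 2 := by
          simp only [Finset.sum_add_distrib, Finset.sum_const, Finset.sum_ite_eq', Finset.mem_univ,
            if_true, Finset.card_univ, Fintype.card_fin, nsmul_eq_mul]
          rw [← Finset.mul_sum]
          simp
          ring
  refine ⟨∑ j, ∑ k, 2 * offGram U j k * c j k, fun t => ?_⟩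
  have : ∑ j, ∑ k, offGram (Function.update U (j₀, i₀) t) j k ^ 2 =
      ∑ j, ∑ k, offGram U j k ^ 2 + (∑ j, ∑ k, 2 * offGram U j k * c j k) * t +
        (∑ j, ∑ k, c j k ^ 2) * t ^ 2 := by
    simp only [hrow, Finset.sum_mul, ← Finset.sum_add_distrib]
    refine Finset.sum_congr rfl fun j _ => Finset.sum_congr rfl fun k _ => ?_
    ring
  rw [this]
  gcongr

/-- The operator norm of the Gram matrix is bounded by its diagonal plus the Hilbert–Schmidt norm of
the rest. -/
lemma sum_sq_sum_mul_le {n l : ℕ} {U : Fin l × Fin n → ℝ} {α : ℝ} (hU : ∀ x, |U x| ≤ α)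
    (θ : Fin l → ℝ) :
    ∑ i, (∑ j, θ j * U (j, i)) ^ 2 ≤
      (n * α ^ 2 + √(∑ j, ∑ k, offGram U j k ^ 2)) * ∑ j, θ j ^ 2 := by
  have hsq : ∀ x, U x ^ 2 ≤ α ^ 2 := fun x => by
    rw [← sq_abs]; exact pow_le_pow_left₀ (abs_nonneg _) (hU x) 2
  have hexp : ∑ i, (∑ j, θ j * U (j, i)) ^ 2 =
      ∑ j, θ j ^ 2 * ∑ i, U (j, i) ^ 2 + ∑ j, ∑ k, (θ j * θ k) * offGram U j k := by
    have h1 : ∑ i, (∑ j, θ j * U (j, i)) ^ 2 = ∑ j, ∑ k, (θ j * θ k) * ∑ i, U (j, i) * U (k, i) := by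
      simp_rw [sq, Finset.sum_mul_sum, Finset.mul_sum]
      rw [Finset.sum_comm]
      refine Finset.sum_congr rfl fun j _ => ?_
      rw [Finset.sum_comm]
      refine Finset.sum_congr rfl fun k _ => Finset.sum_congr rfl fun i _ => ?_
      ring
    rw [h1, ← Finset.sum_add_distrib]
    refine Finset.sum_congr rfl fun j _ => ?_
    have h2 : ∀ k, (θ j * θ k) * ∑ i, U (j, i) * U (k, i) =
        (if k = j then θ j ^ 2 * ∑ i, U (j, i) ^ 2 else 0) + (θ j * θ k) * offGram U j k := by
      intro k
      by_cases hk : k = j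
      · subst hk; simp [offGram, sq]
      · have : j ≠ k := fun h => hk h.symm
        simp [offGram, hk, this]
    simp [h2, Finset.sum_add_distrib]
  have hdiag : ∑ j, θ j ^ 2 * ∑ i, U (j, i) ^ 2 ≤ n * α ^ 2 * ∑ j, θ j ^ 2 := by
    rw [Finset.mul_sum]
    refine Finset.sum_le_sum fun j _ => ?_
    rw [mul_comm]
    gcongr
    calc ∑ i, U (j, i) ^ 2 ≤ ∑ _i : Fin n, α ^ 2 := Finset.sum_le_sum fun i _ => hsq _
      _ = n * α ^ 2 := by simp
  have hoff : ∑ j, ∑ k, (θ j * θ k) * offGram U j k ≤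
      √(∑ j, ∑ k, offGram U j k ^ 2) * ∑ j, θ j ^ 2 := by
    rw [← Finset.sum_product', ← Finset.sum_product']
    have hcs := Finset.sum_mul_sq_le_sq_mul_sq (Finset.univ ×ˢ Finset.univ)
      (fun z : Fin l × Fin l => θ z.1 * θ z.2) (fun z => offGram U z.1 z.2)
    have hθ2 : ∑ z ∈ (Finset.univ ×ˢ Finset.univ : Finset (Fin l × Fin l)), (θ z.1 * θ z.2) ^ 2 =
        (∑ j, θ j ^ 2) ^ 2 := by
      rw [Finset.sum_product' (f := fun a b => (θ a * θ b) ^ 2), sq (∑ j, θ j ^ 2), Finset.sum_mul_sum]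
      simp [mul_pow]
    have hG : 0 ≤ ∑ z ∈ (Finset.univ ×ˢ Finset.univ : Finset (Fin l × Fin l)), offGram U z.1 z.2 ^ 2 :=
      Finset.sum_nonneg fun _ _ => sq_nonneg _
    refine le_of_sq_le_sq ?_ (mul_nonneg (Real.sqrt_nonneg _) (Finset.sum_nonneg fun _ _ => sq_nonneg _))
    rw [mul_pow, Real.sq_sqrt hG, ← hθ2, mul_comm]
    exact hcs
  rw [hexp, add_mul]
  exact add_le_add hdiag hoff

/-- Rounding of a tuple of vectors to the lattice `ρ ℤⁿ`, with control of the image of the rounding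
error under `B` and of its operator norm. -/
lemma exists_rounding {m n l : ℕ} (hn : 1 ≤ n) (hl : 1 ≤ l) {ρ H : ℝ} (hρ : 0 < ρ) (hH : 0 < H)
    (B : Matrix (Fin m) (Fin n) ℝ) (hB : ∑ r, ∑ i, B r i ^ 2 ≤ H)
    (v : Fin l → EuclideanSpace ℝ (Fin n)) :
    ∃ w : Fin l → EuclideanSpace ℝ (Fin n), (∀ j i, ∃ z : ℤ, w j i = ρ * z) ∧
      (∀ j i, |w j i - v j i| ≤ ρ) ∧
      ∑ r, ∑ j, (∑ i, B r i * (w j i - v j i)) ^ 2 ≤ 2 * l * ρ ^ 2 * H ∧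
      ∀ θ : EuclideanSpace ℝ (Fin l),
        ‖∑ j, θ j • (w j - v j)‖ ^ 2 ≤ (n * ρ ^ 2 + 2 * √n * l * ρ ^ 2) * ‖θ‖ ^ 2 := by
  have hn0 : (0 : ℝ) < n := by exact_mod_cast hn
  have hl0 : (0 : ℝ) < l := by exact_mod_cast hl
  -- The weights normalize the two rounding budgets to 1 each. Both terms are nonnegative, so a
  -- total of at most 2 bounds each separately.
  set A := (l * ρ ^ 2 * H)⁻¹ with hA
  set G := (2 * n * l ^ 2 * ρ ^ 4 : ℝ)⁻¹ with hG
  have hA0 : 0 < A := by positivity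
  have hG0 : 0 < G := by positivity
  obtain ⟨U, hU1, hU2, hU3⟩ := exists_greedy_rounding
    (fun U : Fin l × Fin n → ℝ => A * imageEnergy B U + G * ∑ j, ∑ k, offGram U j k ^ 2) hρ
    (fun x => A * (∑ r, B r x.2 ^ 2) + G * (2 * l * ρ ^ 2))
    (fun x => add_nonneg (mul_nonneg hA0.le (Finset.sum_nonneg fun _ _ => sq_nonneg _)) (by positivity))
    (by
      intro U x hU hx
      obtain ⟨b₁, h₁⟩ := imageEnergy_update B U x hx
      obtain ⟨b₂, h₂⟩ := offGram_update hρ hU x hx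
      refine ⟨A * b₁ + G * b₂, fun t => ?_⟩
      have := mul_le_mul_of_nonneg_left (h₂ t) hG0.le
      simp only [h₁ t]
      linarith)
    (fun x => v x.1 x.2)
  have hsum : ∑ x : Fin l × Fin n, (A * (∑ r, B r x.2 ^ 2) + G * (2 * l * ρ ^ 2)) * ρ ^ 2 ≤ 2 := by
    have hcol : ∑ i, ∑ r, B r i ^ 2 ≤ H := by rwa [Finset.sum_comm]
    calc _ = (l * (A * ∑ i, ∑ r, B r i ^ 2) + l * (n * (G * (2 * l * ρ ^ 2)))) * ρ ^ 2 := by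
          rw [Fintype.sum_prod_type]
          simp only [← Finset.sum_mul, Finset.sum_add_distrib, ← Finset.mul_sum, Finset.sum_const,
            Finset.card_univ, Fintype.card_fin, nsmul_eq_mul]
          ring
      _ ≤ (l * (A * H) + l * (n * (G * (2 * l * ρ ^ 2)))) * ρ ^ 2 := by gcongr
      _ = 2 := by
        rw [hA, hG]
        field_simp
        norm_num
  have hF0 : A * imageEnergy B (0 : Fin l × Fin n → ℝ) + G * ∑ j, ∑ k, offGram (0 : Fin l × Fin n → ℝ) j k ^ 2 = 0 := by
    simp [imageEnergy, offGram]
  have hU4 : A * imageEnergy B U + G * ∑ j, ∑ k, offGram U j k ^ 2 ≤ 2 := by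
    simp only [hF0] at hU3
    linarith
  have hI0 : 0 ≤ imageEnergy B U :=
    Finset.sum_nonneg fun _ _ => Finset.sum_nonneg fun _ _ => sq_nonneg _
  have hO0 : 0 ≤ ∑ j, ∑ k, offGram U j k ^ 2 :=
    Finset.sum_nonneg fun _ _ => Finset.sum_nonneg fun _ _ => sq_nonneg _
  have hI : imageEnergy B U ≤ 2 * l * ρ ^ 2 * H := by
    have : A * imageEnergy B U ≤ 2 := by nlinarith [mul_nonneg hG0.le hO0]
    rw [hA, inv_mul_le_iff₀ (by positivity)] at this
    linarith
  have hO : ∑ j, ∑ k, offGram U j k ^ 2 ≤ (2 * √n * l * ρ ^ 2) ^ 2 := by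
    have : G * ∑ j, ∑ k, offGram U j k ^ 2 ≤ 2 := by nlinarith [mul_nonneg hA0.le hI0]
    rw [hG, inv_mul_le_iff₀ (by positivity)] at this
    rw [show (2 * √n * l * ρ ^ 2) ^ 2 = 4 * (√n) ^ 2 * l ^ 2 * ρ ^ 4 by ring, Real.sq_sqrt hn0.le]
    linarith
  refine ⟨fun j => v j + WithLp.toLp 2 fun i => U (j, i), fun j i => ?_, fun j i => ?_, ?_, fun θ => ?_⟩
  · simpa using hU2 (j, i)
  · simpa using hU1 (j, i)
  · simpa [imageEnergy] using hI
  · rw [EuclideanSpace.norm_sq_eq, EuclideanSpace.norm_sq_eq]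
    have h1 := sum_sq_sum_mul_le hU1 θ
    have h2 : √(∑ j, ∑ k, offGram U j k ^ 2) ≤ 2 * √n * l * ρ ^ 2 :=
      Real.sqrt_le_iff.mpr ⟨by positivity, hO⟩
    simp only [Real.norm_eq_abs, sq_abs, WithLp.ofLp_sum, WithLp.ofLp_smul, Finset.sum_apply,
      Pi.smul_apply, smul_eq_mul, add_sub_cancel_left]
    refine h1.trans ?_
    gcongr

/-! ### Counting net points -/

/-- The right side is 1 plus the integral of exp(-c|x|) over [-N, N]; keeping the dependence on `N`
lets the induction close. -/
lemma sum_exp_neg_mul_abs_le {c : ℝ} (hc : 0 < c) (N : ℕ) :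
    ∑ m ∈ Finset.Icc (-(N : ℤ)) N, Real.exp (-(c * |(m : ℝ)|)) ≤
      1 + 2 / c * (1 - Real.exp (-(c * N))) := by
  induction N with
  | zero => simp
  | succ N ih =>
    have hset : Finset.Icc (-((N + 1 : ℕ) : ℤ)) ((N + 1 : ℕ) : ℤ) =
        insert (-((N + 1 : ℕ) : ℤ)) (insert ((N + 1 : ℕ) : ℤ) (Finset.Icc (-(N : ℤ)) N)) := by
      ext m
      simp only [Finset.mem_insert, Finset.mem_Icc]
      omega
    rw [hset, Finset.sum_insert, Finset.sum_insert]
    · have h1 : |(((-((N + 1 : ℕ) : ℤ)) : ℤ) : ℝ)| = N + 1 := by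
        push_cast
        rw [abs_of_nonpos (by linarith [(Nat.cast_nonneg N : (0 : ℝ) ≤ N)])]
        ring
      have h2 : |((((N + 1 : ℕ) : ℤ)) : ℝ)| = N + 1 := by
        push_cast
        rw [abs_of_nonneg (by positivity)]
      rw [h1, h2]
      have h3 : Real.exp (-(c * N)) = Real.exp (-(c * (N + 1))) * Real.exp c := by
        rw [← Real.exp_add]; congr 1; ring
      have h4 := Real.add_one_le_exp c
      have h5 : Real.exp (-(c * (N + 1))) ≤
          1 / c * (Real.exp (-(c * N)) - Real.exp (-(c * (N + 1)))) := by
        rw [h3, one_div, le_inv_mul_iff₀ hc]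
        have := Real.exp_pos (-(c * (N + 1)))
        nlinarith
      have h6 : 2 / c = 2 * (1 / c) := by ring
      push_cast
      rw [h6] at ih ⊢
      linarith
    · simp
    · simp only [Finset.mem_insert, Finset.mem_Icc]
      omega

/-- An integer vector as a point of Euclidean space. -/
noncomputable def intVec {n : ℕ} (z : Fin n → ℤ) : EuclideanSpace ℝ (Fin n) :=
  WithLp.toLp 2 fun i => (z i : ℝ)

/-- Points of the ball have ℓ¹ norm at most √n R, so with c = √n/R each has weight exp(n - c‖z‖₁) ≥
1, and the total weight factorizes over coordinates. -/
lemma card_le_of_norm_intVec_le {n : ℕ} (hn : 1 ≤ n) {R : ℝ} (hR : 0 < R) (T : Finset (Fin n → ℤ))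
    (hT : ∀ z ∈ T, ‖intVec z‖ ≤ R) :
    (T.card : ℝ) ≤ (Real.exp 1 * (1 + 2 * R / √n)) ^ n := by
  have hn0 : (0 : ℝ) < n := by exact_mod_cast hn
  have hsn : 0 < √(n : ℝ) := Real.sqrt_pos.mpr hn0
  have hss : √(n : ℝ) * √n = n := Real.mul_self_sqrt hn0.le
  set c := √(n : ℝ) / R with hc
  have hc0 : 0 < c := by positivity
  set N := ⌈R⌉₊
  have hsub : T ⊆ Fintype.piFinset fun _ => Finset.Icc (-(N : ℤ)) N := by
    intro z hz
    rw [Fintype.mem_piFinset]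
    intro i
    have h1 : |(z i : ℝ)| ≤ N := by
      have := (PiLp.norm_apply_le (intVec z) i).trans (hT z hz)
      simp only [intVec, Real.norm_eq_abs] at this
      exact this.trans (Nat.le_ceil R)
    rw [Finset.mem_Icc, ← abs_le]
    exact_mod_cast h1
  have hl1 : ∀ z ∈ T, ∑ i, |(z i : ℝ)| ≤ √n * R := by
    intro z hz
    have h1 := sq_sum_le_card_mul_sum_sq (s := Finset.univ) (f := fun i => |(z i : ℝ)|)
    have h2 : ∑ i, |(z i : ℝ)| ^ 2 = ‖intVec z‖ ^ 2 := by
      rw [EuclideanSpace.norm_sq_eq]; simp [intVec]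
    rw [h2, Finset.card_univ, Fintype.card_fin] at h1
    refine le_of_sq_le_sq (h1.trans ?_) (by positivity)
    rw [mul_pow, Real.sq_sqrt hn0.le]
    have := hT z hz
    gcongr
  calc (T.card : ℝ) = ∑ z ∈ T, (1 : ℝ) := by simp
    _ ≤ ∑ z ∈ T, Real.exp n * ∏ i, Real.exp (-(c * |(z i : ℝ)|)) := by
        refine Finset.sum_le_sum fun z hz => ?_
        rw [← Real.exp_sum, ← Real.exp_add, Real.one_le_exp_iff, Finset.sum_neg_distrib, ← Finset.mul_sum]
        have h1 : c * ∑ i, |(z i : ℝ)| ≤ c * (√n * R) := by gcongr; exact hl1 z hz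
        have h2 : c * (√n * R) = n := by
          rw [hc, div_mul_eq_mul_div, ← mul_assoc, hss, mul_div_assoc, div_self hR.ne', mul_one]
        linarith
    _ ≤ ∑ z ∈ Fintype.piFinset (fun _ : Fin n => Finset.Icc (-(N : ℤ)) N),
          Real.exp n * ∏ i, Real.exp (-(c * |(z i : ℝ)|)) :=
        Finset.sum_le_sum_of_subset_of_nonneg hsub fun _ _ _ => by positivity
    _ = Real.exp n * ∏ _i : Fin n, ∑ m ∈ Finset.Icc (-(N : ℤ)) N, Real.exp (-(c * |(m : ℝ)|)) := by
        rw [← Finset.mul_sum, Finset.prod_univ_sum]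
    _ ≤ Real.exp n * ∏ _i : Fin n, (1 + 2 * R / √n) := by
        gcongr with i _
        refine (sum_exp_neg_mul_abs_le hc0 N).trans ?_
        have h1 : 2 / c = 2 * R / √n := by rw [hc]; field_simp
        rw [h1]
        have : 0 ≤ 2 * R / √n * Real.exp (-(c * N)) := by positivity
        linarith
    _ = _ := by
        rw [mul_pow, ← Real.exp_nat_mul]
        simp

lemma card_le_of_norm_intVec_sub_le {n : ℕ} (hn : 1 ≤ n) {R : ℝ} (hR : 0 < R)
    (x : EuclideanSpace ℝ (Fin n)) (T : Finset (Fin n → ℤ)) (hT : ∀ z ∈ T, ‖intVec z - x‖ ≤ R) :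
    (T.card : ℝ) ≤ (Real.exp 1 * (3 + 2 * R / √n)) ^ n := by
  have hn0 : (0 : ℝ) < n := by exact_mod_cast hn
  have hsn : 0 < √(n : ℝ) := Real.sqrt_pos.mpr hn0
  set y : Fin n → ℤ := fun i => round (x i)
  have hxy : ‖x - intVec y‖ ≤ √n := by
    rw [EuclideanSpace.norm_eq]
    apply Real.sqrt_le_sqrt
    calc ∑ i, ‖(x - intVec y) i‖ ^ 2 ≤ ∑ _i : Fin n, (1 : ℝ) := by
          refine Finset.sum_le_sum fun i _ => ?_
          have := abs_sub_round (x i)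
          have h0 := abs_nonneg (x i - round (x i))
          simp only [PiLp.sub_apply, intVec, y, Real.norm_eq_abs]
          nlinarith
      _ = n := by simp
  have hinj : Function.Injective fun z : Fin n → ℤ => z - y := sub_left_injective
  have h := card_le_of_norm_intVec_le hn (R := R + √n) (by positivity)
    (T.image fun z => z - y) (by
      intro z' hz'
      obtain ⟨z, hz, rfl⟩ := Finset.mem_image.mp hz'
      have h1 : intVec (z - y) = (intVec z - x) + (x - intVec y) := by
        ext i; simp [intVec]
      rw [h1]
      exact (norm_add_le _ _).trans (add_le_add (hT z hz) hxy))
  rw [Finset.card_image_of_injective _ hinj] at h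
  refine h.trans (le_of_eq ?_)
  congr 2
  field_simp
  ring

/-- The number of points of `ρ ℤⁿ` in a ball which are close to `ℤⁿ`. -/
lemma card_near_lattice_le {n : ℕ} (hn : 1 ≤ n) {ρ R : ℝ} (hρ : 0 < ρ) (hR : 0 < R)
    (T : Finset (Fin n → ℤ)) (hT : ∀ m ∈ T, ‖ρ • intVec m‖ ≤ R)
    (hTz : ∀ m ∈ T, ∃ z : Fin n → ℤ, ‖ρ • intVec m - intVec z‖ ≤ 3 * ρ * √n) :
    (T.card : ℝ) ≤ (9 * Real.exp 1 ^ 2 * (1 + 2 * (R + 3 * ρ * √n) / √n)) ^ n := by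
  classical
  have hn0 : (0 : ℝ) < n := by exact_mod_cast hn
  have hsn : 0 < √(n : ℝ) := Real.sqrt_pos.mpr hn0
  have hch : ∀ m : Fin n → ℤ, ∃ z : Fin n → ℤ, m ∈ T → ‖ρ • intVec m - intVec z‖ ≤ 3 * ρ * √n := by
    intro m
    by_cases hm : m ∈ T
    · obtain ⟨z, hz⟩ := hTz m hm; exact ⟨z, fun _ => hz⟩
    · exact ⟨0, fun h => absurd h hm⟩
  choose f hf using hch
  have himg := card_le_of_norm_intVec_le hn (R := R + 3 * ρ * √n) (by positivity) (T.image f) (by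
    intro z hz
    obtain ⟨m, hm, rfl⟩ := Finset.mem_image.mp hz
    have h1 : intVec (f m) = ρ • intVec m - (ρ • intVec m - intVec (f m)) := by abel
    rw [h1]
    exact (norm_sub_le _ _).trans (add_le_add (hT m hm) (hf m hm)))
  -- After division by ρ, the points assigned to one integer point lie in a ball of radius 3√n,
  -- whence a count independent of ρ.
  have hfib : ∀ z ∈ T.image f, (((T.filter fun m => f m = z).card : ℕ) : ℝ) ≤ (9 * Real.exp 1) ^ n := by
    intro z _
    have h := card_le_of_norm_intVec_sub_le hn (R := 3 * √n) (by positivity) (ρ⁻¹ • intVec z)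
      (T.filter fun m => f m = z) (by
        intro m hm
        obtain ⟨hm1, rfl⟩ := Finset.mem_filter.mp hm
        have h1 : intVec m - ρ⁻¹ • intVec (f m) = ρ⁻¹ • (ρ • intVec m - intVec (f m)) := by
          rw [smul_sub, smul_smul, inv_mul_cancel₀ hρ.ne', one_smul]
        rw [h1, norm_smul, Real.norm_eq_abs, abs_of_pos (by positivity), inv_mul_le_iff₀ hρ]
        linarith [hf m hm1])
    refine h.trans (le_of_eq ?_)
    congr 1
    field_simp
    norm_num
  rw [Finset.card_eq_sum_card_image f T, Nat.cast_sum]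
  calc ∑ z ∈ T.image f, (((T.filter fun m => f m = z).card : ℕ) : ℝ)
      ≤ ∑ z ∈ T.image f, (9 * Real.exp 1) ^ n := Finset.sum_le_sum hfib
    _ = (T.image f).card * (9 * Real.exp 1) ^ n := by simp
    _ ≤ (Real.exp 1 * (1 + 2 * (R + 3 * ρ * √n) / √n)) ^ n * (9 * Real.exp 1) ^ n := by gcongr
    _ = _ := by rw [← mul_pow]; congr 1; ring

lemma geom_sum_le_two_mul {q : ℝ} (hq : 2 ≤ q) (A : ℕ) :
    ∑ a ∈ Finset.range (A + 1), q ^ a ≤ 2 * q ^ A := by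
  induction A with
  | zero => simp
  | succ A ih =>
    rw [Finset.sum_range_succ, pow_succ]
    have : 0 ≤ q ^ A := by positivity
    nlinarith

/-- The sum of inverse powers of the norm over the net, by a dyadic decomposition. -/
lemma sum_net_le {n k : ℕ} (hn : 1 ≤ n) (hk : 1 ≤ k) (hkn : k ≤ n) {τ ρ R : ℝ} (hρ : 0 < ρ)
    (hR : 0 ≤ R) (hτ : 0 < τ) (hτ1 : τ < 1) (hρτ : 64 * ρ ≤ τ) (hn1 : 16 ≤ τ * √n)
    (T : Finset (Fin n → ℤ)) (hT : ∀ m ∈ T, ‖ρ • intVec m‖ ≤ R)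
    (hT0 : ∀ m ∈ T, τ / 16 * √n ≤ ‖ρ • intVec m‖)
    (hTz : ∀ m ∈ T, ∃ z : Fin n → ℤ, ‖ρ • intVec m - intVec z‖ ≤ 3 * ρ * √n) :
    ∑ m ∈ T, (√n / ‖ρ • intVec m‖) ^ (n - k) ≤ 2 * (18 * Real.exp 1 ^ 2 * (16 / τ)) ^ n * R ^ k := by
  classical
  rcases T.eq_empty_or_nonempty with rfl | ⟨m₀, hm₀⟩
  · simp only [Finset.sum_empty]
    positivity
  have hn0 : (0 : ℝ) < n := by exact_mod_cast hn
  have hsn : 0 < √(n : ℝ) := Real.sqrt_pos.mpr hn0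
  set r := τ / 16 * √(n : ℝ) with hr
  have hr0 : 0 < r := by positivity
  -- This gives 2^A ≤ R/r ≤ R for the last dyadic index.
  have hr1 : 1 ≤ r := by rw [hr]; linarith
  have hRr : r ≤ R := (hT0 m₀ hm₀).trans (hT m₀ hm₀)
  obtain ⟨A, hA1, hA2⟩ := exists_nat_pow_near (x := R / r) (y := 2) ((one_le_div hr0).mpr hRr)
    (by norm_num)
  set S : ℕ → Finset (Fin n → ℤ) := fun a =>
    T.filter fun m => 2 ^ a * r ≤ ‖ρ • intVec m‖ ∧ ‖ρ • intVec m‖ ≤ 2 ^ (a + 1) * r with hS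
  have hcov : ∀ m ∈ T, ∃ a ∈ Finset.range (A + 1), m ∈ S a := by
    intro m hm
    obtain ⟨a, ha1, ha2⟩ := exists_nat_pow_near (x := ‖ρ • intVec m‖ / r) (y := 2)
      ((one_le_div hr0).mpr (hT0 m hm)) (by norm_num)
    have haA : a < A + 1 := by
      have h1 : (2 : ℝ) ^ a < 2 ^ (A + 1) :=
        lt_of_le_of_lt (ha1.trans (by gcongr; exact hT m hm)) hA2
      exact (pow_lt_pow_iff_right₀ (by norm_num)).mp h1
    rw [le_div_iff₀ hr0] at ha1
    rw [div_lt_iff₀ hr0] at ha2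
    exact ⟨a, Finset.mem_range.mpr haA, Finset.mem_filter.mpr ⟨hm, ha1, ha2.le⟩⟩
  have hcard : ∀ a, ((S a).card : ℝ) ≤ (18 * Real.exp 1 ^ 2 * 2 ^ a) ^ n := by
    intro a
    have h := card_near_lattice_le hn hρ (R := 2 ^ (a + 1) * r) (by positivity) (S a)
      (fun m hm => (Finset.mem_filter.mp hm).2.2) (fun m hm => hTz m (Finset.mem_filter.mp hm).1)
    refine h.trans ?_
    have h1 : 2 * (2 ^ (a + 1) * r + 3 * ρ * √n) / √n = 2 ^ a * (τ / 4) + 6 * ρ := by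
      rw [hr]; field_simp; ring
    have h2 : (1 : ℝ) ≤ 2 ^ a := one_le_pow₀ (by norm_num)
    rw [h1]
    gcongr ?_ ^ n
    have h3 : 1 + (2 ^ a * (τ / 4) + 6 * ρ) ≤ 2 * 2 ^ a := by nlinarith
    calc _ ≤ 9 * Real.exp 1 ^ 2 * (2 * 2 ^ a) := by gcongr
      _ = _ := by ring
  have hterm : ∀ a, ∑ m ∈ S a, (√n / ‖ρ • intVec m‖) ^ (n - k) ≤
      (18 * Real.exp 1 ^ 2 * (16 / τ)) ^ n * (2 ^ k) ^ a := by
    intro a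
    calc ∑ m ∈ S a, (√n / ‖ρ • intVec m‖) ^ (n - k) ≤ ∑ m ∈ S a, (16 / (τ * 2 ^ a)) ^ (n - k) := by
          refine Finset.sum_le_sum fun m hm => ?_
          have h1 := (Finset.mem_filter.mp hm).2.1
          gcongr ?_ ^ (n - k)
          have : 0 < 2 ^ a * r := by positivity
          calc √n / ‖ρ • intVec m‖ ≤ √n / (2 ^ a * r) := by gcongr
            _ = _ := by rw [hr]; field_simp
      _ = (S a).card * (16 / (τ * 2 ^ a)) ^ (n - k) := by simp
      _ ≤ (18 * Real.exp 1 ^ 2 * 2 ^ a) ^ n * (16 / (τ * 2 ^ a)) ^ (n - k) := by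
          gcongr; exact hcard a
      _ = (18 * Real.exp 1 ^ 2) ^ n * (16 / τ) ^ (n - k) * ((2 ^ a) ^ n / (2 ^ a) ^ (n - k)) := by
          rw [mul_pow, show 16 / (τ * 2 ^ a) = 16 / τ / 2 ^ a by field_simp, div_pow _ (2 ^ a : ℝ)]
          ring
      -- The count grows like 2^{an} and the summand decays like 2^{-a(n-k)}; the k missing rows
      -- leave 2^{ak}.
      _ = (18 * Real.exp 1 ^ 2) ^ n * (16 / τ) ^ (n - k) * (2 ^ k) ^ a := by
          congr 1
          rw [div_eq_iff (by positivity), ← pow_mul, ← pow_mul, ← pow_mul, ← pow_add]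
          congr 1
          rw [mul_comm k a, ← mul_add]
          congr 1
          omega
      _ ≤ (18 * Real.exp 1 ^ 2) ^ n * (16 / τ) ^ n * (2 ^ k) ^ a := by
          gcongr ?_ * ?_ * _
          refine pow_le_pow_right₀ ?_ (Nat.sub_le n k)
          rw [one_le_div hτ]; linarith
      _ = _ := by rw [mul_pow _ (16 / τ)]
  calc ∑ m ∈ T, (√n / ‖ρ • intVec m‖) ^ (n - k)
      ≤ ∑ m ∈ T, ∑ a ∈ Finset.range (A + 1),
          if m ∈ S a then (√n / ‖ρ • intVec m‖) ^ (n - k) else 0 := by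
        refine Finset.sum_le_sum fun m hm => ?_
        obtain ⟨a, ha, hma⟩ := hcov m hm
        refine le_trans (by rw [if_pos hma]) (Finset.single_le_sum (f := fun a =>
          if m ∈ S a then (√n / ‖ρ • intVec m‖) ^ (n - k) else 0) (fun b _ => ?_) ha)
        split_ifs <;> positivity
    _ = ∑ a ∈ Finset.range (A + 1), ∑ m ∈ S a, (√n / ‖ρ • intVec m‖) ^ (n - k) := by
        rw [Finset.sum_comm]
        refine Finset.sum_congr rfl fun a _ => ?_
        rw [← Finset.sum_filter]
        congr 1
        ext m
        simp [hS]
    _ ≤ ∑ a ∈ Finset.range (A + 1), (18 * Real.exp 1 ^ 2 * (16 / τ)) ^ n * (2 ^ k) ^ a :=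
        Finset.sum_le_sum fun a _ => hterm a
    _ = (18 * Real.exp 1 ^ 2 * (16 / τ)) ^ n * ∑ a ∈ Finset.range (A + 1), ((2 : ℝ) ^ k) ^ a := by
        rw [Finset.mul_sum]
    _ ≤ (18 * Real.exp 1 ^ 2 * (16 / τ)) ^ n * (2 * (2 ^ k) ^ A) := by
        gcongr
        refine geom_sum_le_two_mul ?_ A
        simpa using pow_le_pow_right₀ (by norm_num : (1 : ℝ) ≤ 2) hk
    _ ≤ (18 * Real.exp 1 ^ 2 * (16 / τ)) ^ n * (2 * R ^ k) := by
        gcongr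
        rw [← pow_mul, mul_comm, pow_mul]
        gcongr
        exact hA1.trans (div_le_self (by linarith) hr1)
    _ = _ := by ring

/-! ### The law of the random matrix and its two tail bounds -/

/-- The law of an `m × n` matrix with independent entries of law `ν`. -/
noncomputable def matrixLaw (m n : ℕ) (ν : Measure ℝ) : Measure (Fin m → Fin n → ℝ) :=
  Measure.pi fun _ => Measure.pi fun _ => ν

instance (m n : ℕ) (ν : Measure ℝ) [IsProbabilityMeasure ν] : IsProbabilityMeasure (matrixLaw m n ν) := by
  unfold matrixLaw; infer_instance

lemma map_uncurry_matrixLaw (m n : ℕ) (ν : Measure ℝ) [IsProbabilityMeasure ν] :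
    (Measure.pi fun _ : Fin m × Fin n => ν) =
      (matrixLaw m n ν).map fun x (ij : Fin m × Fin n) => x ij.1 ij.2 := by
  refine Measure.pi_eq fun s hs => ?_
  rw [Measure.map_apply (by fun_prop) (MeasurableSet.univ_pi hs)]
  have h1 : (fun (x : Fin m → Fin n → ℝ) (ij : Fin m × Fin n) => x ij.1 ij.2) ⁻¹' (Set.univ.pi s) =
      Set.univ.pi fun r => Set.univ.pi fun i => s (r, i) := by
    ext x
    simp [Set.mem_pi]
  rw [h1, matrixLaw, Measure.pi_pi]
  simp only [Measure.pi_pi]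
  rw [Fintype.prod_prod_type]

lemma map_curry_eq_matrixLaw (m n : ℕ) (ν : Measure ℝ) [IsProbabilityMeasure ν] :
    (Measure.pi fun _ : Fin m × Fin n => ν).map (fun x (r : Fin m) (i : Fin n) => x (r, i)) =
      matrixLaw m n ν := by
  rw [map_uncurry_matrixLaw, Measure.map_map (by fun_prop) (by fun_prop)]
  exact Measure.map_id

lemma IIDEntries.exists_law {Ω : Type*} [MeasurableSpace Ω] {μ : Measure Ω} [IsProbabilityMeasure μ]
    {m n : ℕ} (hm : 1 ≤ m) (hn : 1 ≤ n) {p K : ℝ} (hK : 1 ≤ K) {B : Ω → Matrix (Fin m) (Fin n) ℝ}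
    (hB : IIDEntries p K B μ) :
    ∃ ν : Measure ℝ, IsProbabilityMeasure ν ∧
      ∫⁻ x, ENNReal.ofReal (Real.exp ((x / (2 * K)) ^ 2)) ∂ν ≤ 2 ∧
      (∀ y, ν {x | |x - y| ≤ 1} ≤ ENNReal.ofReal (1 - p)) ∧
      AEMeasurable (fun ω r i => B ω r i) μ ∧ μ.map (fun ω r i => B ω r i) = matrixLaw m n ν := by
  set X : Fin m × Fin n → Ω → ℝ := fun ij ω => B ω ij.1 ij.2 with hX
  have hXm : ∀ ij, AEMeasurable (X ij) μ := fun ij => (hB.entry ij.1 ij.2).aemeasurable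
  set i₀ : Fin m × Fin n := (⟨0, hm⟩, ⟨0, hn⟩)
  have hent := hB.entry i₀.1 i₀.2
  have hprob : IsProbabilityMeasure (μ.map (X i₀)) := Measure.isProbabilityMeasure_map (hXm i₀)
  refine ⟨μ.map (X i₀), hprob, ?_, ?_, ?_, ?_⟩
  · rw [lintegral_map' (by fun_prop) (hXm i₀)]
    -- The slack 2K avoids the question whether the infimum defining the norm is attained.
    have h1 : psi2Norm (X i₀) μ < ENNReal.ofReal (2 * K) :=
      lt_of_le_of_lt hent.psi2Norm_le ((ENNReal.ofReal_lt_ofReal_iff (by linarith)).mpr (by linarith))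
    simp only [psi2Norm, iInf_lt_iff] at h1
    obtain ⟨s, ⟨hs0, hs⟩, hsK⟩ := h1
    have hsK' : s < 2 * K := (ENNReal.ofReal_lt_ofReal_iff (by linarith)).mp hsK
    refine le_trans (lintegral_mono fun ω => ?_) hs
    apply ENNReal.ofReal_le_ofReal
    rw [Real.exp_le_exp, div_pow, div_pow, sq_abs]
    gcongr
  · intro y
    have hms : MeasurableSet {x : ℝ | |x - y| ≤ 1} := measurableSet_le (by fun_prop) (by fun_prop)
    rw [Measure.map_apply_of_aemeasurable (hXm i₀) hms]
    refine le_trans ?_ hent.levy_le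
    exact le_iSup (fun y : ℝ => μ {ω | ‖B ω i₀.1 i₀.2 - y‖ ≤ 1}) y
  · exact aemeasurable_pi_lambda _ fun r => aemeasurable_pi_lambda _ fun i => hXm (r, i)
  · have h1 : μ.map (fun ω ij => X ij ω) = Measure.pi fun _ => μ.map (X i₀) := by
      rw [hB.indep.map_fun_eq_pi_map hXm]
      congr 1
      ext1 ij
      exact (hB.identDistrib ij.1 i₀.1 ij.2 i₀.2).map_eq
    rw [← map_curry_eq_matrixLaw, ← h1, AEMeasurable.map_map_of_aemeasurable
      (Measurable.aemeasurable (by fun_prop))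
      (aemeasurable_pi_lambda _ hXm)]
    rfl

/-- Exponential Markov: the expectation is at most 2^{mn} ≤ exp(n²), and the threshold corresponds
to exp(2n²). The Hilbert–Schmidt norm is used because a tail exp(-n²) is negligible against
exp(-ln), which a tail merely exponential in n need not be. -/
lemma matrixLaw_large_le (m n : ℕ) (hmn : m ≤ n) {K : ℝ} (hK : 0 < K) (ν : Measure ℝ)
    [IsProbabilityMeasure ν]
    (hν : ∫⁻ x, ENNReal.ofReal (Real.exp ((x / (2 * K)) ^ 2)) ∂ν ≤ 2) :
    (matrixLaw m n ν).real {x | 8 * K ^ 2 * n ^ 2 ≤ ∑ r, ∑ i, x r i ^ 2} ≤ Real.exp (-(n : ℝ) ^ 2) := by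
  set f : ℝ → ℝ := fun x => Real.exp ((x / (2 * K)) ^ 2) with hf
  have hfm : Measurable f := by fun_prop
  have hfint : Integrable f ν := by
    refine ⟨hfm.aestronglyMeasurable, ?_⟩
    rw [hasFiniteIntegral_iff_ofReal (Filter.Eventually.of_forall fun x => (Real.exp_pos _).le)]
    exact lt_of_le_of_lt hν (by norm_num)
  have hf2 : ∫ x, f x ∂ν ≤ 2 := by
    rw [integral_eq_lintegral_of_nonneg_ae (Filter.Eventually.of_forall fun x => (Real.exp_pos _).le)
      hfm.aestronglyMeasurable]
    exact ENNReal.toReal_le_of_le_ofReal (by norm_num) (by simpa using hν)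
  have hf0 : 0 ≤ ∫ x, f x ∂ν := integral_nonneg fun x => (Real.exp_pos _).le
  have hrow : Integrable (fun ξ : Fin n → ℝ => ∏ i, f (ξ i)) (Measure.pi fun _ => ν) :=
    Integrable.fintype_prod fun _ => hfint
  have hint : Integrable (fun x : Fin m → Fin n → ℝ => ∏ r, ∏ i, f (x r i)) (matrixLaw m n ν) :=
    Integrable.fintype_prod (f := fun _ (ξ : Fin n → ℝ) => ∏ i, f (ξ i)) fun _ => hrow
  have hval : ∫ x, ∏ r, ∏ i, f (x r i) ∂matrixLaw m n ν ≤ Real.exp ((n : ℝ) ^ 2) := by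
    rw [matrixLaw, integral_fintype_prod_eq_prod (f := fun _ (ξ : Fin n → ℝ) => ∏ i, f (ξ i))]
    simp only [integral_fintype_prod_eq_prod (f := fun _ => f), Finset.prod_const, Finset.card_univ,
      Fintype.card_fin]
    rw [← pow_mul]
    calc (∫ x, f x ∂ν) ^ (n * m) ≤ 2 ^ (n * m) := by gcongr
      _ ≤ 2 ^ (n * n) := by gcongr; norm_num
      _ ≤ Real.exp 1 ^ (n * n) := by
          gcongr; linarith [Real.add_one_le_exp 1]
      _ = _ := by rw [← Real.exp_nat_mul]; push_cast; ring_nf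
  have hmk := mul_meas_ge_le_integral_of_nonneg (Filter.Eventually.of_forall fun x =>
    Finset.prod_nonneg fun r _ => Finset.prod_nonneg fun i _ => (Real.exp_pos _).le) hint
    (Real.exp (2 * (n : ℝ) ^ 2))
  have hsub : {x : Fin m → Fin n → ℝ | 8 * K ^ 2 * n ^ 2 ≤ ∑ r, ∑ i, x r i ^ 2} ⊆
      {x | Real.exp (2 * (n : ℝ) ^ 2) ≤ ∏ r, ∏ i, f (x r i)} := by
    intro x hx
    simp only [Set.mem_ofPred_eq, hf, ← Real.exp_sum] at hx ⊢
    rw [Real.exp_le_exp]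
    have h1 : ∑ r, ∑ i, (x r i / (2 * K)) ^ 2 = (∑ r, ∑ i, x r i ^ 2) / (2 * K) ^ 2 := by
      simp only [div_pow, Finset.sum_div]
    rw [h1, le_div_iff₀ (by positivity)]
    linarith
  have h1 := (mul_le_mul_of_nonneg_left (measureReal_mono (μ := matrixLaw m n ν) hsub)
    (Real.exp_pos (2 * (n : ℝ) ^ 2)).le).trans (hmk.trans hval)
  have h2 : Real.exp ((n : ℝ) ^ 2) = Real.exp (2 * (n : ℝ) ^ 2) * Real.exp (-(n : ℝ) ^ 2) := by
    rw [← Real.exp_add]; congr 1; ring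
  rw [h2] at h1
  exact le_of_mul_le_mul_left h1 (Real.exp_pos _)

/-- Tensorization by Markov's inequality: exp(-y²) ≤ 1/(1 + y²) bounds the exponential of minus the
sum by a product over independent rows. -/
lemma matrixLaw_small_image_le {m n l : ℕ} (ν : Measure ℝ) [IsProbabilityMeasure ν]
    (w : Fin l → Fin n → ℝ) (s : ℝ) :
    (matrixLaw m n ν).real {x | ∑ r, ∑ j, ((∑ i, w j i * x r i) / s) ^ 2 ≤ l * m} ≤
      (Real.exp l * ∫ ξ, ∏ j, 1 / (1 + ((∑ i, w j i * ξ i) / s) ^ 2)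
        ∂(Measure.pi fun _ : Fin n => ν)) ^ m := by
  set g : (Fin n → ℝ) → ℝ := fun ξ => ∏ j, 1 / (1 + ((∑ i, w j i * ξ i) / s) ^ 2) with hg
  have hg0 : ∀ ξ, 0 ≤ g ξ := fun ξ => Finset.prod_nonneg fun j _ => by positivity
  have hg1 : ∀ ξ, g ξ ≤ 1 := fun ξ => by
    refine Finset.prod_le_one (fun j _ => by positivity) fun j _ => ?_
    rw [div_le_one (by positivity)]
    linarith [sq_nonneg ((∑ i, w j i * ξ i) / s)]
  have hgm : Measurable g := by
    refine Finset.measurable_fun_prod _ fun j _ => ?_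
    fun_prop
  have hgint : Integrable g (Measure.pi fun _ : Fin n => ν) :=
    Integrable.of_bound hgm.aestronglyMeasurable 1 (Filter.Eventually.of_forall fun ξ => by
      rw [Real.norm_eq_abs, abs_of_nonneg (hg0 ξ)]; exact hg1 ξ)
  have hint : Integrable (fun x : Fin m → Fin n → ℝ => ∏ r, g (x r)) (matrixLaw m n ν) :=
    Integrable.fintype_prod (f := fun _ => g) fun _ => hgint
  have hval : ∫ x, ∏ r, g (x r) ∂matrixLaw m n ν = (∫ ξ, g ξ ∂(Measure.pi fun _ : Fin n => ν)) ^ m := by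
    rw [matrixLaw, integral_fintype_prod_eq_prod (f := fun _ => g)]
    simp
  have hmk := mul_meas_ge_le_integral_of_nonneg (Filter.Eventually.of_forall fun x =>
    Finset.prod_nonneg fun r _ => hg0 (x r)) hint (Real.exp (-((l : ℝ) * m)))
  have hsub : {x : Fin m → Fin n → ℝ | ∑ r, ∑ j, ((∑ i, w j i * x r i) / s) ^ 2 ≤ l * m} ⊆
      {x | Real.exp (-((l : ℝ) * m)) ≤ ∏ r, g (x r)} := by
    intro x hx
    simp only [Set.mem_ofPred_eq] at hx ⊢
    calc Real.exp (-((l : ℝ) * m)) ≤ Real.exp (∑ r, ∑ j, -((∑ i, w j i * x r i) / s) ^ 2) := by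
          simp only [Finset.sum_neg_distrib]
          rw [Real.exp_le_exp]
          linarith
      _ = ∏ r, ∏ j, Real.exp (-((∑ i, w j i * x r i) / s) ^ 2) := by simp only [Real.exp_sum]
      _ ≤ _ := by
          refine Finset.prod_le_prod (fun r _ => by positivity) fun r _ => ?_
          refine Finset.prod_le_prod (fun j _ => by positivity) fun j _ => ?_
          rw [Real.exp_neg, one_div]
          have := Real.add_one_le_exp (((∑ i, w j i * x r i) / s) ^ 2)
          gcongr
          linarith
  have h1 := (mul_le_mul_of_nonneg_left (measureReal_mono (μ := matrixLaw m n ν) hsub)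
    (Real.exp_pos (-((l : ℝ) * m))).le).trans (hmk.trans hval.le)
  rw [mul_pow, ← Real.exp_nat_mul, mul_comm (m : ℝ)]
  rw [Real.exp_neg, inv_mul_le_iff₀ (Real.exp_pos _)] at h1
  exact h1

/-! ### The net and the union bound -/

/-- The tuple `w` approximates the tuple `v` in each norm up to a factor `2`, and as a linear map up
to `2 ρ √n`. -/
structure Approximates {n l : ℕ} (ρ : ℝ) (v w : Fin l → EuclideanSpace ℝ (Fin n)) : Prop where
  norm_le : ∀ j, ‖w j‖ ≤ 2 * ‖v j‖
  norm_ge : ∀ j, ‖v j‖ ≤ 2 * ‖w j‖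
  norm_sum_le : ∀ θ : EuclideanSpace ℝ (Fin l), ‖∑ j, θ j • (w j - v j)‖ ≤ 2 * ρ * √n * ‖θ‖

lemma GoodTuple.exists_net_tuple {m n l : ℕ} (hn : 1 ≤ n) (hl : 1 ≤ l) {τ ρ L H : ℝ} (hρ : 0 < ρ)
    (hρτ : 16 * ρ ≤ τ) (hln : (l : ℝ) ≤ √n) (hH : 0 < H) (x : Matrix (Fin m) (Fin n) ℝ)
    (hx : ∑ r, ∑ i, x r i ^ 2 ≤ H) {v : Fin l → EuclideanSpace ℝ (Fin n)} (hv : GoodTuple τ ρ L v)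
    (hker : ∀ j, v j ∈ LinearMap.ker x.toEuclideanLin) :
    ∃ M : Fin l → Fin n → ℤ, Approximates ρ v (fun j => ρ • intVec (M j)) ∧
      (∀ j, ∃ z : Fin n → ℤ, ‖ρ • intVec (M j) - intVec z‖ ≤ 3 * ρ * √n) ∧
      ∑ r, ∑ j, (∑ i, (ρ • intVec (M j)) i * x r i) ^ 2 ≤ 2 * l * ρ ^ 2 * H := by
  have hn0 : (0 : ℝ) < n := by exact_mod_cast hn
  have hsn : 0 < √(n : ℝ) := Real.sqrt_pos.mpr hn0
  have hss : √(n : ℝ) * √n = n := Real.mul_self_sqrt hn0.le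
  obtain ⟨w, hw1, hw2, hw3, hw4⟩ := exists_rounding hn hl hρ hH x hx v
  choose M hM using hw1
  have hwM : ∀ j, ρ • intVec (M j) = w j := fun j => by
    ext i
    simp [intVec, hM]
  have hclose : ∀ j, ‖w j - v j‖ ≤ ρ * √n := by
    intro j
    rw [EuclideanSpace.norm_eq]
    refine Real.sqrt_le_iff.mpr ⟨by positivity, ?_⟩
    rw [mul_pow, Real.sq_sqrt hn0.le]
    calc ∑ i, ‖(w j - v j) i‖ ^ 2 ≤ ∑ _i : Fin n, ρ ^ 2 := by
          refine Finset.sum_le_sum fun i _ => ?_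
          exact pow_le_pow_left₀ (norm_nonneg _) (hw2 j i) 2
      _ = ρ ^ 2 * n := by simp [mul_comm]
  have hhalf : ∀ j, ‖w j - v j‖ ≤ ‖v j‖ / 2 := fun j => by
    have h1 := hclose j
    have h2 := hv.norm_ge j
    nlinarith
  refine ⟨M, ?_⟩
  simp only [hwM]
  refine ⟨⟨fun j => ?_, fun j => ?_, fun θ => ?_⟩, fun j => ?_, ?_⟩
  · have h1 := norm_add_le (w j - v j) (v j)
    rw [sub_add_cancel] at h1
    linarith [hhalf j, norm_nonneg (v j)]
  · have h1 := norm_sub_norm_le (v j) (w j)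
    rw [norm_sub_rev] at h1
    linarith [hhalf j]
  · refine le_of_sq_le_sq ((hw4 θ).trans ?_) (by positivity)
    -- As l ≤ √n, the off-diagonal Gram part is at most twice the diagonal one.
    have h1 : n * ρ ^ 2 + 2 * √n * l * ρ ^ 2 ≤ (2 * ρ * √n) ^ 2 := by
      have h2 : √(n : ℝ) * l ≤ n := (mul_le_mul_of_nonneg_left hln hsn.le).trans_eq hss
      rw [mul_pow, Real.sq_sqrt hn0.le]
      nlinarith [sq_nonneg ρ]
    rw [mul_pow _ ‖θ‖]
    gcongr
  · have hne : (intLattice n).Nonempty := ⟨0, fun i => ⟨0, by simp⟩⟩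
    -- A strict bound produces a lattice point without attaining the infimum; the rounding error ρ√n
    -- brings the total to 3ρ√n.
    have h1 : Metric.infDist (v j) (intLattice n) < 2 * ρ * √n :=
      lt_of_le_of_lt (hv.near_lattice j) (by nlinarith [mul_pos hρ hsn])
    obtain ⟨y, hy, hvy⟩ := (Metric.infDist_lt_iff hne).mp h1
    choose z hz using hy
    have hyz : y = intVec z := by
      ext i; simp [intVec, hz]
    refine ⟨z, ?_⟩
    rw [← hyz, ← dist_eq_norm]
    have h2 := dist_triangle (w j) (v j) y
    rw [dist_eq_norm (w j) (v j)] at h2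
    linarith [hclose j]
  · have hxv : ∀ r j, ∑ i, x r i * v j i = 0 := by
      intro r j
      have h1 := LinearMap.mem_ker.mp (hker j)
      have h2 := congrArg (fun y : EuclideanSpace ℝ (Fin m) => y r) h1
      simpa [Matrix.toEuclideanLin, Matrix.toLpLin_apply, Matrix.mulVec, dotProduct] using h2
    refine le_trans (le_of_eq ?_) hw3
    refine Finset.sum_congr rfl fun r _ => Finset.sum_congr rfl fun j _ => ?_
    simp only [mul_sub, Finset.sum_sub_distrib, hxv, sub_zero]
    simp only [mul_comm]

/-- At least half of the n possible rows are present, so D ≤ d² yields d^n, which beats every factor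
exponential in n. -/
lemma net_tail_bound {n k m : ℕ} {D d C R : ℝ} (hn : 1 ≤ n) (hkn : k ≤ n) (hnm : n ≤ 2 * m)
    (hD0 : 0 ≤ D) (hd0 : 0 < d) (hd1 : d ≤ 1) (hC : 0 < C) (hDd : D ≤ d ^ 2) (hR : 0 ≤ R)
    (hRk : R ^ k ≤ Real.exp n) (hdC : d * (C * (2 * Real.exp 1)) ≤ 1 / (4 * Real.exp 1)) :
    D ^ m * (2 * C ^ n * (2 * R) ^ k) ≤ 1 / 2 * Real.exp (-(n : ℝ)) := by
  have h1 : D ^ m ≤ d ^ n := by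
    calc D ^ m ≤ (d ^ 2) ^ m := by gcongr
      _ = d ^ (2 * m) := by rw [pow_mul]
      _ ≤ d ^ n := pow_le_pow_of_le_one hd0.le hd1 hnm
  have h2 : (2 * R) ^ k ≤ (2 * Real.exp 1) ^ n := by
    rw [mul_pow, mul_pow, ← Real.exp_nat_mul, mul_one]
    gcongr
    norm_num
  calc D ^ m * (2 * C ^ n * (2 * R) ^ k) ≤ d ^ n * (2 * C ^ n * (2 * Real.exp 1) ^ n) := by gcongr
    _ = 2 * (d * (C * (2 * Real.exp 1))) ^ n := by rw [mul_pow, mul_pow]; ring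
    _ ≤ 2 * (1 / (4 * Real.exp 1)) ^ n := by gcongr
    _ = 2 * (1 / 4 ^ n) * Real.exp (-(n : ℝ)) := by
        rw [Real.exp_neg, div_pow, mul_pow, ← Real.exp_nat_mul]
        field_simp
        simp
    _ ≤ 2 * (1 / 4 ^ 1) * Real.exp (-(n : ℝ)) := by gcongr; norm_num
    _ = _ := by norm_num

/-- The union bound over the net. -/
lemma sum_piFinset_le {n l m : ℕ} (hl : 1 ≤ l) (T : Finset (Fin n → ℤ))
    (A : Finset (Fin l → Fin n → ℤ)) (hA : ∀ M ∈ A, ∀ j, M j ∈ T) (f : (Fin l → Fin n → ℤ) → ℝ)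
    (g : (Fin n → ℤ) → ℝ) (hg : ∀ z, 0 ≤ g z) (hf : ∀ M ∈ A, f M ≤ ∏ j, g (M j) ^ m)
    (hT : ∑ z ∈ T, g z ^ m ≤ 1 / 2 * Real.exp (-(n : ℝ))) :
    ∑ M ∈ A, f M ≤ 1 / 2 * Real.exp (-((l : ℝ) * n)) := by
  calc ∑ M ∈ A, f M ≤ ∑ M ∈ A, ∏ j, g (M j) ^ m := Finset.sum_le_sum hf
    _ ≤ ∑ M ∈ Fintype.piFinset fun _ => T, ∏ j, g (M j) ^ m :=
        Finset.sum_le_sum_of_subset_of_nonneg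
          (fun M hM => Fintype.mem_piFinset.mpr (hA M hM))
          fun _ _ _ => Finset.prod_nonneg fun j _ => pow_nonneg (hg _) _
    -- The sum over all tuples factorizes, so a gain exp(-n) per vector becomes exp(-ln).
    _ = (∑ z ∈ T, g z ^ m) ^ l := by
        rw [← Finset.prod_univ_sum (fun _ => T) fun _ z => g z ^ m]
        simp
    _ ≤ (1 / 2 * Real.exp (-(n : ℝ))) ^ l := by
        refine pow_le_pow_left₀ (Finset.sum_nonneg fun z _ => pow_nonneg (hg z) _) hT l
    _ = (1 / 2) ^ l * Real.exp (-((l : ℝ) * n)) := by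
        rw [mul_pow, ← Real.exp_nat_mul]; ring_nf
    _ ≤ (1 / 2) ^ 1 * Real.exp (-((l : ℝ) * n)) := by
        gcongr ?_ * _
        exact pow_le_pow_of_le_one (by norm_num) (by norm_num) hl
    _ = _ := by norm_num

/-- A union bound transported along the law of the random matrix. -/
lemma measure_le_of_cover {Ω : Type*} [MeasurableSpace Ω] {μ : Measure Ω} [IsProbabilityMeasure μ]
    {X ι : Type*} [MeasurableSpace X] {Q : Measure X} [IsProbabilityMeasure Q] {Y : Ω → X}
    (hY : AEMeasurable Y μ) (hQ : μ.map Y = Q) {S : Set Ω} {E₀ : Set X} (hE₀ : MeasurableSet E₀)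
    (A : Finset ι) (E : ι → Set X) (hE : ∀ M, MeasurableSet (E M))
    (hS : ∀ ω ∈ S, Y ω ∈ E₀ ∨ ∃ M ∈ A, Y ω ∈ E M) {c : ℝ}
    (h₀ : Q.real E₀ ≤ 1 / 2 * c) (h₁ : ∑ M ∈ A, Q.real (E M) ≤ 1 / 2 * c) :
    μ S ≤ ENNReal.ofReal c := by
  have hm : MeasurableSet (E₀ ∪ ⋃ M ∈ A, E M) :=
    hE₀.union (Finset.measurableSet_biUnion A fun M _ => hE M)
  have hreal : Q.real (E₀ ∪ ⋃ M ∈ A, E M) ≤ c := by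
    refine (measureReal_union_le _ _).trans ?_
    have := measureReal_biUnion_finset_le (μ := Q) A E
    linarith
  -- Only monotonicity is used for `S`, which need not be measurable.
  calc μ S ≤ μ (Y ⁻¹' (E₀ ∪ ⋃ M ∈ A, E M)) := by
        refine measure_mono fun ω hω => ?_
        rcases hS ω hω with h | ⟨M, hM, h⟩
        · exact Or.inl h
        · exact Or.inr (Set.mem_biUnion hM h)
    _ = Q (E₀ ∪ ⋃ M ∈ A, E M) := by rw [← hQ, Measure.map_apply_of_aemeasurable hY hm]
    _ ≤ ENNReal.ofReal c := by
        rw [← ofReal_measureReal]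
        exact ENNReal.ofReal_le_ofReal hreal

/-- The norms of `v` are traded for those of `w`, so that the bound depends on the net tuple alone.
In `D`, the factor e comes from Markov's inequality and the 2 from comparing norms. -/
lemma GoodTuple.matrixLaw_small_image_le {m n l : ℕ} {τ ρ L M p s D : ℝ} (hτ : 0 < τ) (hρ : 0 < ρ)
    (hρτ : 64 * ρ ≤ τ ^ 5) (hp : 0 < p) (hM : 1 ≤ M)
    {v w : Fin l → EuclideanSpace ℝ (Fin n)} (hv : GoodTuple τ ρ L v) (hw : Approximates ρ v w)
    (hl : 1 ≤ l) (hs1 : 1 ≤ s) (hs : 4 * M * l ≤ s)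
    (hprod : ∏ j, ‖v j‖ ≤ Real.exp (p * ρ ^ 2 * n))
    (hD : D * √n = 2 * Real.exp 1 * (40 * (2 + √(32 * Real.pi ^ 3 / (p * τ ^ 8)))) * s)
    (ν : Measure ℝ) [IsProbabilityMeasure ν]
    (hν : p / 2 ≤ (ν.prod ν).real {z | 1 < |z.1 - z.2| ∧ |z.1 - z.2| ≤ M}) :
    (matrixLaw m n ν).real {x | ∑ r, ∑ j, ((∑ i, w j i * x r i) / s) ^ 2 ≤ l * m} ≤
      ∏ j, (D * (√n / ‖w j‖)) ^ m := by
  have hvpos : ∀ j, 0 < ‖v j‖ := fun j => norm_pos_iff.mpr (hv.almostOrthogonal.1 j)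
  refine (RandomKernel.matrixLaw_small_image_le ν (fun j i => w j i) s).trans ?_
  rw [Finset.prod_pow]
  have hrow := hv.integral_row_le hτ hρ hρτ hp hM hw.norm_sum_le hl hs1 hs hprod ν hν
  have h0 : 0 ≤ ∫ ξ, ∏ j, 1 / (1 + ((∑ i, w j i * ξ i) / s) ^ 2) ∂(Measure.pi fun _ : Fin n => ν) :=
    integral_nonneg fun ξ => Finset.prod_nonneg fun j _ => by positivity
  refine pow_le_pow_left₀ (by positivity) ?_ m
  refine (mul_le_mul_of_nonneg_left hrow (Real.exp_pos _).le).trans ?_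
  have he : Real.exp l = ∏ _j : Fin l, Real.exp 1 := by
    simp [← Real.exp_nat_mul]
  rw [he, ← Finset.prod_mul_distrib]
  refine Finset.prod_le_prod (fun j _ => by positivity) fun j _ => ?_
  have h1 := hw.norm_ge j
  have h2 := hvpos j
  have h3 : 0 < ‖w j‖ := by linarith
  set C := 40 * (2 + √(32 * Real.pi ^ 3 / (p * τ ^ 8)))
  have hC : 0 ≤ C := by positivity
  rw [← mul_div_assoc D, hD, ← mul_div_assoc, div_le_div_iff₀ h2 h3]
  have h4 : ‖w j‖ ≤ 2 * ‖v j‖ := hw.norm_le j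
  have h5 : 0 ≤ Real.exp 1 * C * s := by positivity
  nlinarith

end RandomKernel

/-! ### Choice of constants and conclusion -/

set_option maxHeartbeats 1000000 in
open RandomKernel in
theorem proposition5p1 (p K τ : ℝ) (hp : 0 < p) (hK : 1 ≤ K) (hτ0 : 0 < τ) (hτ1 : τ < 1) :
    ∃ ρ₀ : ℝ, 0 < ρ₀ ∧ ∀ ρ : ℝ, 0 < ρ → ρ < ρ₀ →
      ∀ n k l : ℕ, 1 ≤ l → l ≤ k → (k : ℝ) ≤ ρ / 2 * √n →
      ∀ (Ω : Type*) [MeasurableSpace Ω] (μ : Measure Ω) [IsProbabilityMeasure μ]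
        (B : Ω → Matrix (Fin (n - k)) (Fin n) ℝ), RandomKernel.IIDEntries p K B μ →
        μ (RandomKernel.kernelEvent l τ ρ (√((k : ℝ) / p)) B) ≤
          ENNReal.ofReal (Real.exp (-((l : ℝ) * n))) := by
  classical
  obtain ⟨M, hM1, hM⟩ := exists_truncation hp hK
  -- For s = cρ√n, the part 2M ensures 4Ml ≤ s because 2l ≤ ρ√n, and 6K ensures that the rounding
  -- error passes the threshold lms².
  set c := 6 * K + 2 * M with hc
  have hc0 : 0 < c := by positivity
  set D₀ := 2 * Real.exp 1 * (40 * (2 + √(32 * Real.pi ^ 3 / (p * τ ^ 8)))) * c with hD₀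
  have hD₀0 : 0 < D₀ := by positivity
  set C := 18 * Real.exp 1 ^ 2 * (16 / τ) with hC
  have hC0 : 0 < C := by positivity
  have he1 : 1 ≤ Real.exp 1 := Real.one_le_exp (by norm_num)
  have hC1 : 1 ≤ C := by
    have h1 : 1 ≤ 16 / τ := by rw [one_le_div hτ0]; linarith
    have h2 : 1 ≤ Real.exp 1 ^ 2 := one_le_pow₀ he1
    calc (1 : ℝ) ≤ 18 * 1 * 1 := by norm_num
      _ ≤ C := by rw [hC]; gcongr
  set d := 1 / (8 * Real.exp 1 ^ 2 * C) with hd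
  have hd0 : 0 < d := by positivity
  have hd1 : d ≤ 1 := by
    rw [hd, div_le_one (by positivity)]
    have h2 : 1 ≤ Real.exp 1 ^ 2 := one_le_pow₀ he1
    calc (1 : ℝ) ≤ 8 * 1 * 1 := by norm_num
      _ ≤ 8 * Real.exp 1 ^ 2 * C := by gcongr
  have hdC : d * (C * (2 * Real.exp 1)) ≤ 1 / (4 * Real.exp 1) := by
    refine le_of_eq ?_
    rw [hd]; field_simp; norm_num
  -- The first bound serves the lattice distances, the second makes the small ball factor beat the
  -- size of the net.
  refine ⟨min (τ ^ 5 / 64) (d ^ 2 / D₀), by positivity, ?_⟩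
  intro ρ hρ hρlt n k l hl hlk hkn
  obtain ⟨m, hm⟩ : ∃ m, m = n - k := ⟨_, rfl⟩
  rw [← hm]
  intro Ω _ μ _ B hB
  have hρτ5 : 64 * ρ ≤ τ ^ 5 := by linarith [hρlt.trans_le (min_le_left _ _)]
  have hρd : D₀ * ρ ≤ d ^ 2 := by
    have := hρlt.trans_le (min_le_right _ _)
    rw [lt_div_iff₀ hD₀0] at this
    linarith
  have hρτ : 64 * ρ ≤ τ := by
    refine hρτ5.trans ?_
    simpa using pow_le_pow_of_le_one hτ0.le hτ1.le (by norm_num : 1 ≤ 5)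
  have hk : 1 ≤ k := hl.trans hlk
  have hkR : (1 : ℝ) ≤ k := by exact_mod_cast hk
  have hlR : (1 : ℝ) ≤ l := by exact_mod_cast hl
  have hlkR : (l : ℝ) ≤ k := by exact_mod_cast hlk
  -- As k ≥ 1, the hypothesis on k already forces n to be large.
  have hρn : 2 ≤ ρ * √n := by linarith
  have hsn1 : 128 ≤ √(n : ℝ) := by
    by_contra hcon
    push Not at hcon
    have : ρ * √n ≤ ρ * 128 := by gcongr
    linarith
  have hss : √(n : ℝ) * √n = n := Real.mul_self_sqrt (Nat.cast_nonneg n)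
  have hτn : 16 ≤ τ * √n := by
    have := mul_le_mul_of_nonneg_right hρτ (Real.sqrt_nonneg (n : ℝ))
    linarith
  have h2sn : 2 * √(n : ℝ) ≤ n := by
    refine le_of_le_of_eq ?_ hss
    gcongr
    linarith
  have hnR : (1 : ℝ) ≤ n := by linarith
  have hn : 1 ≤ n := by exact_mod_cast hnR
  have hksn : (k : ℝ) ≤ √n :=
    hkn.trans (mul_le_of_le_one_left (Real.sqrt_nonneg _) (by linarith))
  have h2kn : 2 * k ≤ n := by
    have : (2 * k : ℝ) ≤ n := by linarith
    exact_mod_cast this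
  have hm1 : 1 ≤ m := by omega
  have hnm : n ≤ 2 * m := by omega
  have hnmR : (n : ℝ) ≤ 2 * m := by exact_mod_cast hnm
  obtain ⟨ν, hνp, hνexp, hνlevy, hBm, hlaw⟩ := hB.exists_law hm1 hn hK
  have hp1 : p ≤ 1 := levy_parameter_le_one hνlevy
  have hν := hM ν hνexp hνlevy
  set R := Real.exp (ρ ^ 2 * n / (4 * √((k : ℝ) / p) ^ 2)) with hR
  have hR1 : 1 ≤ R := Real.one_le_exp (by positivity)
  have hRk : R ^ k = Real.exp (p * ρ ^ 2 * n / 4) := by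
    rw [hR, ← Real.exp_nat_mul, Real.sq_sqrt (by positivity)]
    congr 1
    field_simp
  set s := c * (ρ * √n) with hs
  have hs0 : 0 < s := by positivity
  have hc6 : 6 ≤ c := by linarith
  have hs1 : 1 ≤ s := by
    have : 6 * 2 ≤ c * (ρ * √n) := by gcongr
    linarith
  have hsl : 4 * M * l ≤ s := by
    have h1 : 2 * (l : ℝ) ≤ ρ * √n := by linarith
    calc 4 * M * l = 2 * M * (2 * l) := by ring
      _ ≤ 2 * M * (ρ * √n) := by gcongr
      _ ≤ s := by rw [hs]; gcongr; linarith
  set H := 8 * K ^ 2 * (n : ℝ) ^ 2 with hH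
  have hH0 : 0 < H := by positivity
  set N := ⌈2 * R / ρ⌉₊ with hN
  set T : Finset (Fin n → ℤ) := (Fintype.piFinset fun _ => Finset.Icc (-(N : ℤ)) N).filter fun z =>
    ‖ρ • intVec z‖ ≤ 2 * R ∧ τ / 16 * √n ≤ ‖ρ • intVec z‖ ∧
      ∃ y : Fin n → ℤ, ‖ρ • intVec z - intVec y‖ ≤ 3 * ρ * √n with hT
  have hTmem : ∀ z : Fin n → ℤ, ‖ρ • intVec z‖ ≤ 2 * R → τ / 16 * √n ≤ ‖ρ • intVec z‖ →
      (∃ y : Fin n → ℤ, ‖ρ • intVec z - intVec y‖ ≤ 3 * ρ * √n) → z ∈ T := by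
    intro z h1 h2 h3
    refine Finset.mem_filter.mpr ⟨Fintype.mem_piFinset.mpr fun i => ?_, h1, h2, h3⟩
    have h4 := (PiLp.norm_apply_le (ρ • intVec z) i).trans h1
    simp only [intVec, PiLp.smul_apply, smul_eq_mul, Real.norm_eq_abs, abs_mul, abs_of_pos hρ] at h4
    have h5 : |(z i : ℝ)| ≤ N := by
      refine le_trans ?_ (Nat.le_ceil _)
      rw [le_div_iff₀ hρ]
      linarith
    rw [Finset.mem_Icc, ← abs_le]
    exact_mod_cast h5
  have hTsum : ∑ z ∈ T, (D₀ * ρ * (√n / ‖ρ • intVec z‖)) ^ m ≤ 1 / 2 * Real.exp (-(n : ℝ)) := by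
    simp only [mul_pow (D₀ * ρ)]
    rw [← Finset.mul_sum]
    refine le_trans ?_ (net_tail_bound hn (by omega : k ≤ n) hnm (by positivity) hd0 hd1 hC0 hρd
      (by linarith : 0 ≤ R) ?_ hdC)
    · have h := sum_net_le hn hk (by omega) hρ (by linarith) hτ0 hτ1 hρτ hτn T
        (fun z hz => (Finset.mem_filter.mp hz).2.1) (fun z hz => (Finset.mem_filter.mp hz).2.2.1)
        (fun z hz => (Finset.mem_filter.mp hz).2.2.2)
      rw [← hm] at h
      exact mul_le_mul_of_nonneg_left h (by positivity)
    · rw [hRk, Real.exp_le_exp]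
      have h1 : ρ ^ 2 ≤ 1 := pow_le_one₀ hρ.le (by linarith)
      have h2 : p * ρ ^ 2 ≤ 1 := mul_le_one₀ hp1 (by positivity) h1
      have h3 : p * ρ ^ 2 * n ≤ 1 * n := by gcongr
      linarith
  -- Only net tuples that approximate some good tuple are kept: the small ball estimate draws its
  -- structure from that deterministic tuple.
  set A : Finset (Fin l → Fin n → ℤ) := (Fintype.piFinset fun _ => T).filter fun z =>
    ∃ v : Fin l → EuclideanSpace ℝ (Fin n), GoodTuple τ ρ (√((k : ℝ) / p)) v ∧
      Approximates ρ v fun j => ρ • intVec (z j) with hA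
  have hprod : ∀ v : Fin l → EuclideanSpace ℝ (Fin n), GoodTuple τ ρ (√((k : ℝ) / p)) v →
      ∏ j, ‖v j‖ ≤ Real.exp (p * ρ ^ 2 * n) := by
    intro v hv
    calc ∏ j, ‖v j‖ ≤ ∏ _j : Fin l, R := Finset.prod_le_prod (fun _ _ => norm_nonneg _) fun j _ =>
          hv.norm_le j
      _ = R ^ l := by simp
      _ ≤ R ^ k := pow_le_pow_right₀ hR1 hlk
      _ ≤ _ := by
          rw [hRk, Real.exp_le_exp]
          have : 0 ≤ p * ρ ^ 2 * n := by positivity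
          linarith
  refine measure_le_of_cover hBm hlaw (E₀ := {x | H ≤ ∑ r, ∑ i, x r i ^ 2})
    (measurableSet_le (by fun_prop) (by fun_prop)) A
    (fun z => {x | ∑ r, ∑ j, ((∑ i, (ρ • intVec (z j)) i * x r i) / s) ^ 2 ≤ l * m})
    (fun z => measurableSet_le (by fun_prop) (by fun_prop)) ?_ ?_ ?_
  · rintro ω ⟨v, hker, hv⟩
    by_cases hbig : H ≤ ∑ r, ∑ i, B ω r i ^ 2
    · exact Or.inl hbig
    right
    obtain ⟨z, hz1, hz2, hz3⟩ := hv.exists_net_tuple hn hl hρ (by linarith) (hlkR.trans hksn) hH0 (B ω)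
      (not_le.mp hbig).le hker
    refine ⟨z, Finset.mem_filter.mpr ⟨Fintype.mem_piFinset.mpr fun j => ?_, v, hv, hz1⟩, ?_⟩
    · refine hTmem _ ((hz1.norm_le j).trans ?_) ?_ (hz2 j)
      · exact mul_le_mul_of_nonneg_left (hv.norm_le j) (by norm_num)
      · have h1 := hz1.norm_ge j
        have h2 := hv.norm_ge j
        linarith
    · simp only [Set.mem_ofPred_eq, div_pow, ← Finset.sum_div]
      rw [div_le_iff₀ (by positivity)]
      refine hz3.trans ?_
      have hs2 : s ^ 2 = c ^ 2 * ρ ^ 2 * n := by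
        rw [hs, mul_pow, mul_pow, Real.sq_sqrt (by positivity)]; ring
      have hcK : 36 * K ^ 2 ≤ c ^ 2 := by
        have h : (6 * K) ^ 2 ≤ c ^ 2 := by
          gcongr; linarith
        linarith [mul_pow 6 K 2]
      rw [hs2, hH]
      calc 2 * (l : ℝ) * ρ ^ 2 * (8 * K ^ 2 * n ^ 2) = l * ρ ^ 2 * n * (16 * K ^ 2 * n) := by ring
        _ ≤ l * ρ ^ 2 * n * (16 * K ^ 2 * (2 * m)) := by gcongr
        _ ≤ l * ρ ^ 2 * n * (c ^ 2 * m) := by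
            have h1 := mul_le_mul_of_nonneg_right hcK (Nat.cast_nonneg (α := ℝ) m)
            have h2 : 0 ≤ K ^ 2 * m := by positivity
            have h3 : 16 * K ^ 2 * (2 * m) ≤ c ^ 2 * m := by linarith
            gcongr
        _ = _ := by ring
  · refine (matrixLaw_large_le m n (by omega) (by linarith) ν hνexp).trans ?_
    have h1 : (1 : ℝ) / 2 * Real.exp (-((l : ℝ) * n)) =
        Real.exp (-(n : ℝ) ^ 2) * (1 / 2 * Real.exp ((n : ℝ) ^ 2 - l * n)) := by
      rw [mul_left_comm, ← Real.exp_add]; congr 2; ring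
    rw [h1]
    refine le_mul_of_one_le_right (Real.exp_pos _).le ?_
    have h2 := Real.add_one_le_exp ((n : ℝ) ^ 2 - l * n)
    have h3 : (2 * l : ℝ) ≤ n := by
      have : (2 * k : ℝ) ≤ n := by exact_mod_cast h2kn
      linarith
    have h4 := mul_le_mul_of_nonneg_right h3 (Nat.cast_nonneg (α := ℝ) n)
    have h5 : (2 : ℝ) * 2 ≤ n * n := by
      gcongr <;> linarith
    rw [sq] at h2 ⊢
    linarith
  · refine sum_piFinset_le hl T A (fun z hz => Fintype.mem_piFinset.mp (Finset.mem_filter.mp hz).1) _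
      (fun z => D₀ * ρ * (√n / ‖ρ • intVec z‖)) (fun z => by positivity) (fun z hz => ?_) hTsum
    obtain ⟨v, hv, hz1⟩ := (Finset.mem_filter.mp hz).2
    refine hv.matrixLaw_small_image_le hτ0 hρ hρτ5 hp hM1 hz1 hl hs1 hsl (hprod v hv) ?_ ν hν
    rw [hD₀, hs]
    ring
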